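/- Let $p$ be a prime number and $k$ a finite extension of $\mathbb{Q}_p$, with ring of integers $\mathcal{O}_k$ and uniformiser $\pi$. For an integer $n\ge 1$ let $$A_n=\mathcal{O}_k[[S,T]]/(S^nT-\pi),\qquad B_n=A_n\otimes_{\mathcal{O}_k}k,\qquad \mathcal{C}_n=\operatorname{Spec}B_n .$$ Let $\eta:\operatorname{Spec}\Omega\to\mathcal{C}_n$ be a geometric point, with $\Omega$ an algebraically closed field. Let $\bar k$ be the algebraic closure of $k$ in $\Omega$, $G_k=\operatorname{Gal}(\bar k/k)$ the absolute Galois group of $k$ with its Krull topology, $\mathcal{C}_{n,\bar k}=\mathcal{C}_n\times_{\operatorname{Spec}k}\operatorname{Spec}\bar k$, and $\bar\eta$ the geometric point of $\mathcal{C}_{n,\bar k}$ induced by $\eta$. Write $\pi_1(\mathcal{C}_n,\eta)$ and $\pi_1(\mathcal{C}_{n,\bar k},\bar\eta)$ for the étale fundamental groups, $\pi_1(\mathcal{C}_{n,\bar k},\bar\eta)^{\mathrm{ab}}$ for the maximal abelian profinite quotient of the latter (the quotient by the closure of the commutator subgroup), and let $\pi_1(\mathcal{C}_n,\eta)^{(\mathrm{ab})}$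 be the geometrically abelian quotient of $\pi_1(\mathcal{C}_n,\eta)$, i.e. the push-out of the extension $$1\to\pi_1(\mathcal{C}_{n,\bar k},\bar\eta)\to\pi_1(\mathcal{C}_n,\eta)\to G_k\to1$$ along $\pi_1(\mathcal{C}_{n,\bar k},\bar\eta)\to\pi_1(\mathcal{C}_{n,\bar k},\bar\eta)^{\mathrm{ab}}$. Then, for every $n\ge 1$, the projection $\pi_1(\mathcal{C}_n,\eta)^{(\mathrm{ab})}\to G_k$ splits: there is a continuous group homomorphism $s:G_k\to\pi_1(\mathcal{C}_n,\eta)^{(\mathrm{ab})}$ whose composite with the projection is the identity of $G_k$. -/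

import Mathlib

open CategoryTheory CategoryTheory.Limits AlgebraicGeometry
universe u

noncomputable section

namespace EtaleFG

/-- A finite étale cover of the scheme `X`: a scheme `left` with a finite étale morphism
`hom : left ⟶ X`. -/
structure FinEtCover (X : Scheme.{u}) where
  left : Scheme.{u}
  hom : left ⟶ X
  [isFinite : IsFinite hom]
  [etale : Etale hom]

namespace FinEtCover
variable {X X' : Scheme.{u}}

attribute [instance] isFinite etale

/-- A morphism of finite étale covers of `X` is a morphism of schemes over `X`. -/
@[ext]
structure Hom (Y Z : FinEtCover X) where
  left : Y.left ⟶ Z.left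
  w : left ≫ Z.hom = Y.hom

instance : Category (FinEtCover X) where
  Hom := Hom
  id Y := ⟨𝟙 Y.left, Category.id_comp _⟩
  comp f g := ⟨f.left ≫ g.left, by rw [Category.assoc, g.w, f.w]⟩
  id_comp f := Hom.ext (Category.id_comp _)
  comp_id f := Hom.ext (Category.comp_id _)
  assoc f g h := Hom.ext (Category.assoc _ _ _)

/-- The pullback of a finite étale cover of `X` along `f : X' ⟶ X`. -/
abbrev pullbackObj (Y : FinEtCover X) (f : X' ⟶ X) : FinEtCover X' :=
  ⟨pullback Y.hom f, pullback.snd Y.hom f⟩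

/-- Base change of finite étale covers along `f : X' ⟶ X`, as a functor. -/
def baseChange (f : X' ⟶ X) : FinEtCover X ⥤ FinEtCover X' where
  obj Y := Y.pullbackObj f
  map {Y Z} g := ⟨pullback.lift (pullback.fst Y.hom f ≫ g.left) (pullback.snd Y.hom f)
    (by rw [Category.assoc, g.w, pullback.condition]), pullback.lift_snd _ _ _⟩
  map_id Y := Hom.ext (by
    apply pullback.hom_ext
    · rw [pullback.lift_fst]; exact (Category.comp_id _).trans (Category.id_comp _).symm
    · rw [pullback.lift_snd]; exact (Category.id_comp _).symm)
  map_comp {Y Z W} g h := Hom.ext (by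
    apply pullback.hom_ext
    · rw [pullback.lift_fst]
      refine Eq.trans ?_ (Category.assoc _ _ _).symm
      rw [pullback.lift_fst, ← Category.assoc, pullback.lift_fst]
      exact (Category.assoc _ _ _).symm
    · rw [pullback.lift_snd]
      refine Eq.trans ?_ (Category.assoc _ _ _).symm
      rw [pullback.lift_snd, pullback.lift_snd])

end FinEtCover

section Points
variable {Ω : Type u} [Field Ω]

theorem finite_sections {Y : Scheme.{u}} (g : Y ⟶ Spec (.of Ω)) [IsFinite g] :
    Finite {y : Spec (.of Ω) ⟶ Y // y ≫ g = 𝟙 _} := by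
  have : IsAffine Y := isAffine_of_isAffineHom g
  let e := Y.isoSpec
  let φ : CommRingCat.of Ω ⟶ Γ(Y, ⊤) := Spec.preimage (e.inv ≫ g)
  have hφ : Spec.map φ = e.inv ≫ g := Spec.map_preimage _
  algebraize [φ.hom]
  have h1 : IsFinite (Spec.map φ) := by rw [hφ]; infer_instance
  have : Module.Finite Ω Γ(Y, ⊤) := IsFinite.SpecMap_iff φ |>.mp h1
  let F : {y : Spec (.of Ω) ⟶ Y // y ≫ g = 𝟙 _} → (Γ(Y, ⊤) →ₐ[Ω] Ω) := fun y =>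
    { (Spec.preimage (y.1 ≫ e.hom)).hom with
      commutes' := by
        intro r
        have : φ ≫ Spec.preimage (y.1 ≫ e.hom) = 𝟙 _ := by
          apply Spec.map_injective
          rw [Spec.map_comp, Spec.map_preimage, hφ, Spec.map_id]
          simpa using y.2
        exact ConcreteCategory.congr_hom this r }
  refine Finite.of_injective F fun y y' h => ?_
  have h2 : Spec.preimage (y.1 ≫ e.hom) = Spec.preimage (y'.1 ≫ e.hom) := by
    ext r; exact DFunLike.congr_fun h r
  have h3 := congrArg Spec.map h2
  rw [Spec.map_preimage, Spec.map_preimage] at h3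
  exact Subtype.ext ((cancel_mono e.hom).mp h3)

theorem finite_points {X Y : Scheme.{u}} (x : Spec (.of Ω) ⟶ X) (g : Y ⟶ X) [IsFinite g] :
    Finite {y : Spec (.of Ω) ⟶ Y // y ≫ g = x} := by
  have := finite_sections (pullback.snd g x)
  refine Finite.of_injective
    (β := {y : Spec (.of Ω) ⟶ pullback g x // y ≫ pullback.snd g x = 𝟙 _})
    (fun y => ⟨pullback.lift y.1 (𝟙 _) (by rw [y.2, Category.id_comp]), pullback.lift_snd _ _ _⟩)
    fun y y' h => Subtype.ext ?_
  have := congrArg (· ≫ pullback.fst g x) (Subtype.ext_iff.mp h)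
  dsimp only at this
  rwa [pullback.lift_fst, pullback.lift_fst] at this

end Points

section Pi1

variable {Ω : Type u} [Field Ω] {X X' : Scheme.{u}}

/-- The fibre of the cover `Y` over the geometric point `x : Spec Ω ⟶ X`: the set of geometric
points `Spec Ω ⟶ Y` that lie over `x`. -/
@[ext]
structure GeomFiber (x : Spec (.of Ω) ⟶ X) (Y : FinEtCover X) : Type u where
  pt : Spec (.of Ω) ⟶ Y.left
  w : pt ≫ Y.hom = x

instance (x : Spec (.of Ω) ⟶ X) (Y : FinEtCover X) : Finite (GeomFiber x Y) :=
  have := finite_points x Y.hom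
  Finite.of_injective (β := {y : Spec (.of Ω) ⟶ Y.left // y ≫ Y.hom = x})
    (fun y => ⟨y.pt, y.w⟩) fun _ _ h => GeomFiber.ext (congrArg Subtype.val h)

/-- A morphism of covers maps the fibre of the one to the fibre of the other. -/
def GeomFiber.map (x : Spec (.of Ω) ⟶ X) {Y Z : FinEtCover X} (f : Y ⟶ Z) (y : GeomFiber x Y) :
    GeomFiber x Z :=
  ⟨y.pt ≫ f.left, by rw [Category.assoc, f.w, y.w]⟩

/-- The fibre functor at the geometric point `x` on the category of finite étale covers of `X`. -/
def fiberFunctor (x : Spec (.of Ω) ⟶ X) : FinEtCover X ⥤ FintypeCat.{u} where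
  obj Y := FintypeCat.of (GeomFiber x Y)
  map f := FintypeCat.homMk (GeomFiber.map x f)
  map_id _ := FintypeCat.hom_ext _ _ fun y => GeomFiber.ext (Category.comp_id y.pt)
  map_comp _ _ := FintypeCat.hom_ext _ _ fun y => GeomFiber.ext (Category.assoc y.pt _ _).symm

/-- The étale fundamental group `π₁(X, x)`: the group of automorphisms of the fibre functor at the
geometric point `x`, with its profinite topology (the coarsest one for which the actions on the
finite discrete fibres are continuous). -/
abbrev Pi1 (x : Spec (.of Ω) ⟶ X) : Type (u + 1) := Aut (fiberFunctor x)

/-- For `f : X' ⟶ X` and `x' ↦ x`, the fibre over `x'` of the pullback of `Y` along `f` is the fibre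
of `Y` over `x`. -/
def fiberBaseChange (f : X' ⟶ X) (x' : Spec (.of Ω) ⟶ X')
    (x : Spec (.of Ω) ⟶ X) (h : x' ≫ f = x) (Y : FinEtCover X) :
    GeomFiber x' (Y.pullbackObj f) ≃ GeomFiber x Y where
  toFun y := ⟨y.pt ≫ pullback.fst Y.hom f, by
    rw [Category.assoc, pullback.condition, ← Category.assoc, y.w, h]⟩
  invFun y := ⟨pullback.lift y.pt x' (y.w.trans h.symm), pullback.lift_snd _ _ _⟩
  left_inv y := by
    refine GeomFiber.ext (pullback.hom_ext ?_ ?_)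
    · exact pullback.lift_fst _ _ _
    · exact (pullback.lift_snd _ _ _).trans y.w.symm
  right_inv y := GeomFiber.ext (pullback.lift_fst _ _ _)

/-- The bijections `fiberBaseChange` are natural in the cover. -/
def fiberBaseChangeIso (f : X' ⟶ X) (x' : Spec (.of Ω) ⟶ X')
    (x : Spec (.of Ω) ⟶ X) (h : x' ≫ f = x) :
    FinEtCover.baseChange f ⋙ fiberFunctor x' ≅ fiberFunctor x :=
  NatIso.ofComponents
    (fun Y => FintypeCat.equivEquivIso (A := FintypeCat.of _) (B := FintypeCat.of _)
      (fiberBaseChange f x' x h Y))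
    (fun {Y Z} g => FintypeCat.hom_ext _ _ fun y => GeomFiber.ext (by
      have h1 : pullback.lift (pullback.fst Y.hom f ≫ g.left) (pullback.snd Y.hom f)
          (by rw [Category.assoc, g.w, pullback.condition]) ≫ pullback.fst Z.hom f =
          pullback.fst Y.hom f ≫ g.left := pullback.lift_fst _ _ _
      exact ((Category.assoc _ _ _).trans (congrArg (y.pt ≫ ·) h1)).trans
        (Category.assoc _ _ _).symm))

/-- The homomorphism `π₁(X', x') → π₁(X, x)` induced by `f : X' ⟶ X` with `x' ↦ x`: an automorphism
of the fibre functor at `x'` acts on the fibre at `x` of a cover of `X` through the pullback of the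
cover to `X'`. -/
def Pi1.map (f : X' ⟶ X) (x' : Spec (.of Ω) ⟶ X')
    (x : Spec (.of Ω) ⟶ X) (h : x' ≫ f = x) : Pi1 x' →* Pi1 x :=
  (fiberBaseChangeIso f x' x h).conjAut.toMonoidHom.comp
    (((Functor.whiskeringLeft _ _ FintypeCat.{u}).obj (FinEtCover.baseChange f)).mapAut
      (fiberFunctor x'))

/-- `π₁(X, x)` acts on the fibres over `x`. -/
instance (x : Spec (.of Ω) ⟶ X) (Y : FinEtCover X) : MulAction (Pi1 x) (GeomFiber x Y) :=
  inferInstanceAs (MulAction (Aut (fiberFunctor x)) ((fiberFunctor x).obj Y))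

theorem Pi1.map_smul (f : X' ⟶ X) (x' : Spec (.of Ω) ⟶ X')
    (x : Spec (.of Ω) ⟶ X) (h : x' ≫ f = x) (σ : Pi1 x') (Y : FinEtCover X) (y : GeomFiber x Y) :
    Pi1.map f x' x h σ • y =
      fiberBaseChange f x' x h Y (σ • (fiberBaseChange f x' x h Y).symm y) := rfl

theorem Pi1.smul_fiberMap (x : Spec (.of Ω) ⟶ X) {Y Z : FinEtCover X} (g : Y ⟶ Z)
    (σ : Pi1 x) (y : GeomFiber x Y) :
    σ • GeomFiber.map x g y = GeomFiber.map x g (σ • y) :=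
  ConcreteCategory.congr_hom (σ.hom.naturality g) y

open PreGaloisCategory in
theorem Pi1.continuous_map (f : X' ⟶ X) (x' : Spec (.of Ω) ⟶ X')
    (x : Spec (.of Ω) ⟶ X) (h : x' ≫ f = x) : Continuous (Pi1.map f x' x h) := by
  rw [continuous_induced_rng]
  refine continuous_pi fun Y => ?_
  let c : Aut ((fiberFunctor x').obj (Y.pullbackObj f)) → Aut ((fiberFunctor x).obj Y) :=
    ((fiberBaseChangeIso f x' x h).app Y).conjAut
  have hc : Continuous c := continuous_of_discreteTopology
  have h1 : Continuous fun σ : Pi1 x' => autEmbedding (fiberFunctor x') σ (Y.pullbackObj f) :=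
    (continuous_apply _).comp continuous_induced_dom
  have h2 : (fun σ : Pi1 x' => autEmbedding (fiberFunctor x) (Pi1.map f x' x h σ) Y) =
      c ∘ fun σ : Pi1 x' => autEmbedding (fiberFunctor x') σ (Y.pullbackObj f) :=
    funext fun σ => Iso.ext (FintypeCat.hom_ext _ _ fun _ => rfl)
  exact h2 ▸ hc.comp h1

open PreGaloisCategory in
theorem Pi1.isOpen_stabilizer (x : Spec (.of Ω) ⟶ X) {Y : FinEtCover X} (y : GeomFiber x Y) :
    IsOpen {σ : Pi1 x | σ • y = y} :=
  stabilizer_isOpen (Aut (fiberFunctor x)) (show (fiberFunctor x).obj Y from y)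

/-- If the pullback of a cover `Y` of `X` to `X'` has a section (that is, if `f` lifts to a morphism
`g : X' ⟶ Y`), then the image of `π₁(X', x')` fixes the point of the fibre that it gives. -/
theorem Pi1.map_smul_of_lift (f : X' ⟶ X) (x' : Spec (.of Ω) ⟶ X')
    (x : Spec (.of Ω) ⟶ X) (h : x' ≫ f = x) (σ : Pi1 x') (Y : FinEtCover X)
    (g : X' ⟶ Y.left) (hg : g ≫ Y.hom = f) (y : GeomFiber x Y) (hy : y.pt = x' ≫ g) :
    Pi1.map f x' x h σ • y = y := by
  let E : FinEtCover X' := ⟨X', 𝟙 X'⟩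
  let s : E ⟶ Y.pullbackObj f :=
    ⟨pullback.lift g (𝟙 X') (by rw [hg, Category.id_comp]), pullback.lift_snd _ _ _⟩
  let e : GeomFiber x' E := ⟨x', Category.comp_id _⟩
  have he : σ • e = e := GeomFiber.ext (by
    have h1 := (σ • e).w
    exact ((Category.comp_id _).symm.trans h1))
  have hs : (fiberBaseChange f x' x h Y).symm y = GeomFiber.map x' s e := by
    refine GeomFiber.ext (pullback.hom_ext ?_ ?_)
    · refine (pullback.lift_fst _ _ _).trans (hy.trans ?_)
      exact (congrArg (x' ≫ ·) (pullback.lift_fst _ _ _).symm).trans (Category.assoc _ _ _).symm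
    · refine (pullback.lift_snd _ _ _).trans ?_
      refine Eq.trans ?_ (Category.assoc _ _ _).symm
      exact (Category.comp_id _).symm.trans (congrArg (x' ≫ ·) (pullback.lift_snd _ _ _).symm)
  rw [Pi1.map_smul, hs, Pi1.smul_fiberMap, he, ← hs, Equiv.apply_symm_apply]

end Pi1

section Gal
/-- The morphism `Spec Ω ⟶ Spec k` given by a field extension `Ω / k`. -/
abbrev specAlg (k Ω : Type u) [Field k] [Field Ω] [Algebra k Ω] :
    Spec (.of Ω) ⟶ Spec (.of k) :=
  Spec.map (CommRingCat.ofHom (algebraMap k Ω))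

variable (k Ω : Type u) [Field k] [CharZero k] [Field Ω] [Algebra k Ω]

/-- For a finite extension `L` of a field `k` of characteristic zero, the finite étale cover
`Spec L` of `Spec k`. -/
def fieldCover (L : Type u) [Field L] [Algebra k L] [FiniteDimensional k L] :
    FinEtCover (Spec (.of k)) where
  left := Spec (.of L)
  hom := specAlg k L
  isFinite := (IsFinite.SpecMap_iff _).mpr (RingHom.finite_algebraMap.mpr inferInstance)
  etale := by
    rw [HasRingHomProperty.Spec_iff (P := @Etale)]
    have : Algebra.FormallyEtale k L := Algebra.FormallyEtale.of_isSeparable k L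
    have : Algebra.FinitePresentation k L := Algebra.FinitePresentation.of_finiteType.mp inferInstance
    have : Algebra.Etale k L := {}
    exact RingHom.etale_algebraMap.mpr this

variable {k Ω}
variable {L L' : Type u} [Field L] [Algebra k L] [FiniteDimensional k L]
  [Field L'] [Algebra k L'] [FiniteDimensional k L']

/-- The geometric points of the cover `Spec L` of `Spec k` over `Spec Ω ⟶ Spec k` are the
`k`-embeddings of `L` into `Ω`. -/
def fieldPoint : (L →ₐ[k] Ω) ≃ GeomFiber (specAlg k Ω) (fieldCover k L) where
  toFun φ := ⟨Spec.map (CommRingCat.ofHom φ.toRingHom), by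
    refine (Spec.map_comp _ _).symm.trans (congrArg Spec.map ?_)
    ext r; exact φ.commutes r⟩
  invFun y := { (Spec.preimage y.pt).hom with
    commutes' := fun r => by
      have : CommRingCat.ofHom (algebraMap k L) ≫ Spec.preimage y.pt =
          CommRingCat.ofHom (algebraMap k Ω) := by
        apply Spec.map_injective
        exact ((Spec.map_comp _ _).trans (congrArg (· ≫ (fieldCover k L).hom)
          (Spec.map_preimage y.pt))).trans y.w
      exact ConcreteCategory.congr_hom this r }
  left_inv φ := by
    ext r
    exact ConcreteCategory.congr_hom (Spec.preimage_map (CommRingCat.ofHom φ.toRingHom)) r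
  right_inv y := GeomFiber.ext (Spec.map_preimage y.pt)

/-- The morphism of covers given by a `k`-embedding of finite extensions. -/
def fieldCoverMap (j : L →ₐ[k] L') : fieldCover k L' ⟶ fieldCover k L :=
  ⟨Spec.map (CommRingCat.ofHom j.toRingHom), by
    refine (Spec.map_comp _ _).symm.trans (congrArg Spec.map ?_)
    ext r; exact j.commutes r⟩

theorem map_fieldPoint (j : L →ₐ[k] L') (φ : L' →ₐ[k] Ω) :
    GeomFiber.map _ (fieldCoverMap j) (fieldPoint φ) = fieldPoint (φ.comp j) :=
  GeomFiber.ext (Spec.map_comp _ _).symm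

/-- The action of `π₁(Spec k)` on the `k`-embeddings `L → Ω`, for `L / k` finite. -/
def embAct (σ : Pi1 (specAlg k Ω)) (φ : L →ₐ[k] Ω) : L →ₐ[k] Ω :=
  fieldPoint.symm (σ • fieldPoint φ)

theorem embAct_comp (σ : Pi1 (specAlg k Ω)) (j : L →ₐ[k] L') (φ : L' →ₐ[k] Ω) :
    embAct σ (φ.comp j) = (embAct σ φ).comp j := by
  rw [embAct, Equiv.symm_apply_eq, ← map_fieldPoint, Pi1.smul_fiberMap, ← map_fieldPoint, embAct,
    Equiv.apply_symm_apply]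

theorem embAct_one (φ : L →ₐ[k] Ω) : embAct 1 φ = φ := by
  rw [embAct, one_smul, Equiv.symm_apply_apply]

theorem embAct_mul (σ τ : Pi1 (specAlg k Ω)) (φ : L →ₐ[k] Ω) :
    embAct (σ * τ) φ = embAct σ (embAct τ φ) := by
  rw [embAct, embAct, embAct, Equiv.apply_symm_apply, mul_smul]

open IntermediateField

instance (x : algebraicClosure k Ω) : FiniteDimensional k k⟮(x : Ω)⟯ :=
  adjoin.finiteDimensional (mem_algebraicClosure_iff'.mp x.2)

/-- The value of `σ` at an element `x` of `Ω` algebraic over `k`: the image of `x` under the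
`k`-embedding to which `σ` moves the inclusion of `k(x)` in `Ω`. -/
def valAct (σ : Pi1 (specAlg k Ω)) (x : algebraicClosure k Ω) : Ω :=
  embAct σ (k⟮(x : Ω)⟯.val) (AdjoinSimple.gen k (x : Ω))

theorem valAct_eq (σ : Pi1 (specAlg k Ω)) (x : algebraicClosure k Ω) (φ : L →ₐ[k] Ω) (l : L)
    (h : φ l = x) : valAct σ x = embAct σ φ l := by
  have hle : k⟮(x : Ω)⟯ ≤ φ.fieldRange := by
    rw [adjoin_simple_le_iff]; exact ⟨l, h⟩
  let e : L ≃ₐ[k] φ.fieldRange := AlgEquiv.ofInjectiveField φ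
  let j : k⟮(x : Ω)⟯ →ₐ[k] L := e.symm.toAlgHom.comp (inclusion hle)
  have hj : ∀ z, φ (j z) = z := fun z => congrArg Subtype.val (e.apply_symm_apply (inclusion hle z))
  have h1 : φ.comp j = k⟮(x : Ω)⟯.val := AlgHom.ext hj
  have h2 : j (AdjoinSimple.gen k (x : Ω)) = l := φ.injective ((hj _).trans h.symm)
  rw [valAct, ← h1, embAct_comp, AlgHom.comp_apply, h2]

theorem isAlgebraic_valAct (σ : Pi1 (specAlg k Ω)) (x : algebraicClosure k Ω) :
    valAct σ x ∈ algebraicClosure k Ω :=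
  mem_algebraicClosure_iff'.mpr
    (((Algebra.IsIntegral.isIntegral (R := k) (AdjoinSimple.gen k (x : Ω)))).map _)

theorem exists_common {k Ω : Type u} [Field k] [Field Ω] [Algebra k Ω]
    (x y : algebraicClosure k Ω) :
    ∃ K : IntermediateField k Ω, FiniteDimensional k K ∧ (x : Ω) ∈ K ∧ (y : Ω) ∈ K :=
  ⟨k⟮(x : Ω)⟯ ⊔ k⟮(y : Ω)⟯, inferInstance,
    (le_sup_left : _ ≤ k⟮(x : Ω)⟯ ⊔ k⟮(y : Ω)⟯) (mem_adjoin_simple_self k _),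
    (le_sup_right : _ ≤ k⟮(x : Ω)⟯ ⊔ k⟮(y : Ω)⟯) (mem_adjoin_simple_self k _)⟩

/-- The `k`-endomorphism of the algebraic closure of `k` in `Ω` that is glued from the actions
on the embeddings into `Ω` of the finite extensions of `k` in `Ω`. -/
def algAct (σ : Pi1 (specAlg k Ω)) : algebraicClosure k Ω →ₐ[k] algebraicClosure k Ω where
  toFun x := ⟨valAct σ x, isAlgebraic_valAct σ x⟩
  map_one' := Subtype.ext (by
    change valAct σ 1 = 1
    rw [valAct_eq σ 1 (⊥ : IntermediateField k Ω).val 1 rfl, map_one])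
  map_zero' := Subtype.ext (by
    change valAct σ 0 = 0
    rw [valAct_eq σ 0 (⊥ : IntermediateField k Ω).val 0 rfl, map_zero])
  map_mul' x y := Subtype.ext (by
    obtain ⟨K, _, hx, hy⟩ := exists_common x y
    change valAct σ (x * y) = valAct σ x * valAct σ y
    rw [valAct_eq σ x K.val ⟨x, hx⟩ rfl, valAct_eq σ y K.val ⟨y, hy⟩ rfl,
      valAct_eq σ (x * y) K.val (⟨x, hx⟩ * ⟨y, hy⟩) rfl, map_mul])
  map_add' x y := Subtype.ext (by
    obtain ⟨K, _, hx, hy⟩ := exists_common x y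
    change valAct σ (x + y) = valAct σ x + valAct σ y
    rw [valAct_eq σ x K.val ⟨x, hx⟩ rfl, valAct_eq σ y K.val ⟨y, hy⟩ rfl,
      valAct_eq σ (x + y) K.val (⟨x, hx⟩ + ⟨y, hy⟩) rfl, map_add])
  commutes' r := Subtype.ext (by
    change valAct σ (algebraMap k _ r) = algebraMap k Ω r
    rw [valAct_eq σ (algebraMap k _ r) (⊥ : IntermediateField k Ω).val (algebraMap k _ r) rfl,
      AlgHom.commutes])

theorem algAct_apply (σ : Pi1 (specAlg k Ω)) (φ : L →ₐ[k] Ω) (l : L)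
    (h : φ l ∈ algebraicClosure k Ω) : (algAct σ ⟨φ l, h⟩ : Ω) = embAct σ φ l :=
  valAct_eq σ _ φ l rfl

/-- `algAct` as a homomorphism of monoids. -/
def algActHom : Pi1 (specAlg k Ω) →* (algebraicClosure k Ω →ₐ[k] algebraicClosure k Ω) where
  toFun := algAct
  map_one' := AlgHom.ext fun x => Subtype.ext (by
    refine (valAct_eq 1 x k⟮(x : Ω)⟯.val (AdjoinSimple.gen k (x : Ω)) rfl).trans ?_
    rw [embAct_one]; rfl)
  map_mul' σ τ := AlgHom.ext fun x => Subtype.ext (by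
    refine (valAct_eq (σ * τ) x k⟮(x : Ω)⟯.val (AdjoinSimple.gen k (x : Ω)) rfl).trans ?_
    rw [embAct_mul]
    exact (valAct_eq σ (algAct τ x) _ _ rfl).symm)

/-- The canonical homomorphism `π₁(Spec k, Spec Ω) → Gal(k̄ / k)`, where `k̄` is the algebraic closure
of `k` in `Ω`. It is characterised by `toGal_apply`: `σ` acts on a finite subextension as it acts on
the embedding of that subextension in `Ω`, which is a point of a fibre. -/
def toGal : Pi1 (specAlg k Ω) →* Gal(algebraicClosure k Ω/k) :=
  (AlgEquiv.algHomUnitsEquiv k (algebraicClosure k Ω)).toMonoidHom.comp algActHom.toHomUnits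

theorem toGal_apply (σ : Pi1 (specAlg k Ω)) (φ : L →ₐ[k] Ω) (l : L)
    (h : φ l ∈ algebraicClosure k Ω) : (toGal σ ⟨φ l, h⟩ : Ω) = fieldPoint.symm (σ • fieldPoint φ) l :=
  algAct_apply σ φ l h

theorem continuous_toGal : Continuous (toGal (k := k) (Ω := Ω)) := by
  refine continuous_of_continuousAt_one _ ?_
  intro U hU
  rw [map_one, krullTopology_mem_nhds_one_iff] at hU
  obtain ⟨E, hE, hEU⟩ := hU
  have := hE
  let φ : E →ₐ[k] Ω := (algebraicClosure k Ω).val.comp E.val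
  refine Filter.mem_map.mpr <| Filter.mem_of_superset
    ((Pi1.isOpen_stabilizer _ (fieldPoint φ)).mem_nhds (one_smul _ (fieldPoint φ))) ?_
  intro σ hσ
  refine hEU ((mem_fixingSubgroup_iff _ _).mpr fun x hx => Subtype.ext ?_)
  refine (toGal_apply σ φ ⟨x, hx⟩ x.2).trans ?_
  rw [show σ • fieldPoint φ = fieldPoint φ from hσ, Equiv.symm_apply_apply]
  rfl

end Gal

section Extension

variable {k Ω : Type u} [Field k] [Field Ω] [Algebra k Ω] {X : Scheme.{u}}
  (f : X ⟶ Spec (.of k)) (η : Spec (.of Ω) ⟶ X) (hη : η ≫ f = specAlg k Ω)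

/-- The projection `π₁(X, η) → G_k = Gal(k̄ / k)` for a `k`-scheme `f : X ⟶ Spec k` and a geometric
point `η` of `X` over `Spec Ω ⟶ Spec k`; `k̄` is the algebraic closure of `k` in `Ω`. -/
def projGal [CharZero k] : Pi1 η →* Gal(algebraicClosure k Ω/k) :=
  toGal.comp (Pi1.map f η (specAlg k Ω) hη)

theorem continuous_projGal [CharZero k] : Continuous (projGal f η hη) :=
  continuous_toGal.comp (Pi1.continuous_map _ _ _ _)

theorem specAlg_comp (k L Ω : Type u) [Field k] [Field L] [Field Ω] [Algebra k L] [Algebra L Ω]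
    [Algebra k Ω] [IsScalarTower k L Ω] : specAlg L Ω ≫ specAlg k L = specAlg k Ω := by
  rw [← Spec.map_comp, ← CommRingCat.ofHom_comp, ← IsScalarTower.algebraMap_eq]

variable (Ω) in
/-- The geometric fibre `X_k̄ = X ×_{Spec k} Spec k̄`. -/
abbrev geomScheme : Scheme.{u} := pullback f (specAlg k (algebraicClosure k Ω))

/-- The geometric point `η̄` of `X_k̄` that is induced by `η`. -/
def geomPoint : Spec (.of Ω) ⟶ geomScheme Ω f :=
  pullback.lift η (specAlg (algebraicClosure k Ω) Ω) (hη.trans (specAlg_comp _ _ _).symm)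

theorem geomPoint_fst : geomPoint f η hη ≫ pullback.fst _ _ = η := pullback.lift_fst _ _ _

/-- The homomorphism `π₁(X_k̄, η̄) → π₁(X, η)`. -/
def geomToArith : Pi1 (geomPoint f η hη) →* Pi1 η :=
  Pi1.map (pullback.fst _ _) (geomPoint f η hη) η (geomPoint_fst f η hη)

theorem Pi1.map_map {X Y Z : Scheme.{u}} (g : X ⟶ Y) (h : Y ⟶ Z) (x : Spec (.of Ω) ⟶ X)
    (y : Spec (.of Ω) ⟶ Y) (z : Spec (.of Ω) ⟶ Z) (hxy : x ≫ g = y) (hyz : y ≫ h = z)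
    (σ : Pi1 x) (W : FinEtCover Z) (w : GeomFiber z W)
    (l : X ⟶ W.left) (hl : l ≫ W.hom = g ≫ h) (hw : w.pt = x ≫ l) :
    Pi1.map h y z hyz (Pi1.map g x y hxy σ) • w = w := by
  rw [Pi1.map_smul, Pi1.map_smul_of_lift g x y hxy σ (W.pullbackObj h)
    (pullback.lift l g hl) (pullback.lift_snd _ _ _), Equiv.apply_symm_apply]
  refine pullback.hom_ext ?_ ?_
  · refine (pullback.lift_fst _ _ _).trans (hw.trans ?_)
    exact (congrArg (x ≫ ·) (pullback.lift_fst _ _ _).symm).trans (Category.assoc _ _ _).symm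
  · refine (pullback.lift_snd _ _ _).trans ?_
    refine Eq.trans ?_ (Category.assoc _ _ _).symm
    exact hxy.symm.trans (congrArg (x ≫ ·) (pullback.lift_snd _ _ _).symm)

theorem projGal_geomToArith [CharZero k] (σ : Pi1 (geomPoint f η hη)) :
    projGal f η hη (geomToArith f η hη σ) = 1 := by
  refine AlgEquiv.ext fun x => Subtype.ext ?_
  let j : IntermediateField.adjoin k {(x : Ω)} →ₐ[k] algebraicClosure k Ω :=
    IntermediateField.inclusion (IntermediateField.adjoin_simple_le_iff.mpr x.2)
  let φ : IntermediateField.adjoin k {(x : Ω)} →ₐ[k] Ω := (algebraicClosure k Ω).val.comp j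
  refine (toGal_apply _ φ (IntermediateField.AdjoinSimple.gen k (x : Ω)) x.2).trans ?_
  rw [geomToArith, Pi1.map_map (pullback.fst _ _) f _ η _ _ hη σ _ (fieldPoint φ)
    (pullback.snd _ _ ≫ Spec.map (CommRingCat.ofHom j.toRingHom)), Equiv.symm_apply_apply]
  · rfl
  · refine (Category.assoc _ _ _).trans (Eq.trans ?_ pullback.condition.symm)
    refine congrArg (pullback.snd _ _ ≫ ·) ((Spec.map_comp _ _).symm.trans (congrArg Spec.map ?_))
    ext r; exact congrArg Subtype.val (j.commutes r)
  · refine Eq.trans ?_ (Category.assoc _ _ _)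
    have : geomPoint f η hη ≫ pullback.snd _ _ = specAlg (algebraicClosure k Ω) Ω :=
      pullback.lift_snd _ _ _
    rw [this]
    change Spec.map (CommRingCat.ofHom φ.toRingHom) = _
    exact Spec.map_comp (CommRingCat.ofHom j.toRingHom)
      (CommRingCat.ofHom (algebraMap (algebraicClosure k Ω) Ω))

/-- The kernel of `π₁(X, η) → π₁(X, η)^(ab)`: the closed normal subgroup of `π₁(X, η)` generated by
the image of the kernel of `π₁(X_k̄, η̄) → π₁(X_k̄, η̄)^ab`, which is the closure of the commutator
subgroup. -/
def geomCommutator : Subgroup (Pi1 η) :=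
  (Subgroup.normalClosure ((_root_.commutator (Pi1 (geomPoint f η hη))).topologicalClosure.map
    (geomToArith f η hη) : Set (Pi1 η))).topologicalClosure

instance : (geomCommutator f η hη).Normal :=
  Subgroup.is_normal_topologicalClosure _

theorem geomCommutator_le_ker [CharZero k] : geomCommutator f η hη ≤ (projGal f η hη).ker := by
  refine Subgroup.topologicalClosure_minimal _ (Subgroup.normalClosure_le_normal ?_) ?_
  · rintro _ ⟨σ, -, rfl⟩
    exact projGal_geomToArith f η hη σ
  · exact isClosed_singleton.preimage (continuous_projGal f η hη)

/-- The geometrically abelian quotient `π₁(X, η)^(ab)` of `π₁(X, η)`, the push-out of `π₁(X, η)` along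
`π₁(X_k̄, η̄) → π₁(X_k̄, η̄)^ab`, as a topological group. -/
abbrev Pi1GeomAb : Type (u + 1) := Pi1 η ⧸ geomCommutator f η hη

/-- The projection `π₁(X, η)^(ab) → G_k`. -/
def projGalAb [CharZero k] : Pi1GeomAb f η hη →* Gal(algebraicClosure k Ω/k) :=
  QuotientGroup.lift _ (projGal f η hη) (geomCommutator_le_ker f η hη)

end Extension

section Annulus
open scoped TensorProduct
variable (O : Type u) [CommRing O] (k : Type u) [Field k] [Algebra O k] (π : O) (n : ℕ)

/-- The ring `A_n = O⟦S, T⟧ / (Sⁿ T - π)`, with `S = X 0` and `T = X 1`. -/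
abbrev AnnulusRing : Type u :=
  MvPowerSeries (Fin 2) O ⧸
    Ideal.span {MvPowerSeries.X 0 ^ n * MvPowerSeries.X 1 - MvPowerSeries.C (σ := Fin 2) π}

/-- The scheme `C_n = Spec (A_n ⊗_O k)`. -/
def openAnnulus : Scheme.{u} := Spec (.of (k ⊗[O] AnnulusRing O π n))

/-- The structure morphism `C_n ⟶ Spec k`. -/
def openAnnulus.toSpec : openAnnulus O k π n ⟶ Spec (.of k) :=
  Spec.map (CommRingCat.ofHom (algebraMap k (k ⊗[O] AnnulusRing O π n)))
end Annulus

end EtaleFG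

end

open EtaleFG

/-!
The splitting comes from two points of `C_n` with residue fields of coprime degrees over `k`. The
equation `Sⁿ T = π` has the solutions `S = T = x` with `x ^ (n + 1) = π` and `S = x`, `T = x ^ 2`
with `x ^ (n + 2) = π`, and the polynomials `X ^ d - π` are Eisenstein, so that `C_n` has points
over extensions `L` of `k` of the degrees `n + 1` and `n + 2` (`exists_algHom_tensor_annulusRing`). A
point over `L` gives a section of `π₁(C_n) → G_k` over an open subgroup of index `[L : k]`
(`exists_section_of_algHom`). The kernel of `π₁(C_n)^(ab) → G_k` is abelian, and the class of an
extension by an abelian group that splits over a subgroup of finite index `d` is killed by `d`, by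
transfer. As `n + 1` and `n + 2` are coprime, the class is trivial; the transfer is carried out with
continuous cochains in `exists_continuous_section_of_coprime_index`.

The fundamental groups are only accessible as automorphism groups of fibre functors, so sections and
lifts of elements are built from group actions on the fibres. The tool is the absolute integral
closure `R` of the domain `B` with `C_n = Spec B`: every finite étale cover of `Spec R` is split, so
for every homomorphism `R → T` to a domain, a `T`-point of a cover over `Spec R → Spec B` extends
uniquely to `R` (`uniqueLifting_specMap`). The fibre of a cover of `Spec B` over `η` is therefore
its set of `T`-points over `B`, and a group acting on `T` over `B` maps to `π₁(C_n, η)`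
(`LiftingAction.toPi1`). With `T = k̄` this gives the sections over open subgroups. With `T = R` and
the Galois group of the fraction field of `B` it gives all of `π₁(C_n, η)`, if `B` is normal,
because this Galois group acts transitively on the points of a connected component of a cover; the
elements that are trivial in `G_k` fix `k̄ ⊆ R` and thus come from `π₁(C_{n, k̄})`. This is the
exactness `ker_projGal_le_range_geomToArith`, from which the kernel of `π₁(C_n)^(ab) → G_k` is abelian.

The ring `B` is a localization of `A_n`, which is normal because `S` is a regular element and
`A_n / (S)` is the normal ring `(O / π)⟦T⟧` (`isIntegrallyClosed_of_quotient_span_singleton`).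
-/

namespace EtaleFG

/-! ### Splitting an extension with abelian kernel -/

section Splitting

variable {E G : Type*} [Group E] [Group G] {q : E →* G}

/-- A homomorphic section over an open subgroup `H` extends to a continuous section of sets over the
whole group which is right `H`-equivariant. -/
theorem exists_equivariant_section [TopologicalSpace E] [IsTopologicalGroup E]
    [TopologicalSpace G] [IsTopologicalGroup G] (hq : Function.Surjective q)
    (H : Subgroup G) (hH : IsOpen (H : Set G)) (s : H →* E) (hs : Continuous s)
    (hqs : ∀ h, q (s h) = h) :
    ∃ t : G → E, Continuous t ∧ (∀ g, q (t g) = g) ∧ ∀ g (h : H), t (g * h) = t g * s h := by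
  choose e he using hq
  have hmem (g : G) : (g : G ⧸ H).out⁻¹ * g ∈ H := by
    rw [← QuotientGroup.eq, QuotientGroup.out_eq']
  refine ⟨fun g => e (g : G ⧸ H).out * s ⟨_, hmem g⟩, ?_, ?_, ?_⟩
  · have : DiscreteTopology (G ⧸ H) := QuotientGroup.discreteTopology hH
    have h1 : Continuous fun g : G => (g : G ⧸ H) := QuotientGroup.continuous_mk
    have h2 : Continuous fun g : G => (g : G ⧸ H).out :=
      (continuous_of_discreteTopology (f := fun c : G ⧸ H => c.out)).comp h1
    have h3 : Continuous fun g : G => e (g : G ⧸ H).out :=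
      (continuous_of_discreteTopology (f := fun c : G ⧸ H => e c.out)).comp h1
    exact h3.mul (hs.comp ((h2.inv.mul continuous_id).subtype_mk _))
  · intro g
    rw [map_mul, he, hqs]
    simp
  · intro g h
    have h1 : ((g * h : G) : G ⧸ H) = g := QuotientGroup.mk_mul_of_mem g h.2
    change e ((g * h : G) : G ⧸ H).out * s _ = e (g : G ⧸ H).out * s _ * s h
    rw [mul_assoc, ← map_mul]
    have h2 : (⟨_, hmem (g * h)⟩ : H) = ⟨_, hmem g⟩ * h := Subtype.ext (by simp [h1, mul_assoc])
    rw [h2, h1]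

/-- The transfer argument: if the extension `q` with abelian kernel has a right `H`-equivariant
section `t'`, then its class, represented by the cocycle
`(x, y) ↦ t x * t y * (t (x * y))⁻¹` of a section `t`, is killed by the index of `H`. -/
theorem exists_coboundary_pow_index [TopologicalSpace E] [IsTopologicalGroup E]
    [TopologicalSpace G] [IsTopologicalGroup G] (hcomm : IsMulCommutative q.ker)
    (H : Subgroup G) [H.FiniteIndex] (s : H →* E)
    (t t' : G → E) (ht : Continuous t) (ht' : Continuous t')
    (hqt : ∀ g, q (t g) = g) (hqt' : ∀ g, q (t' g) = g)
    (hts : ∀ g (h : H), t' (g * h) = t' g * s h)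
    (a : G → G → q.ker) (ha : ∀ x y, (a x y : E) = t x * t y * (t (x * y))⁻¹) :
    ∃ b : G → q.ker, Continuous b ∧
      ∀ x y, a x y ^ H.index * b (x * y) = MulAut.conjNormal (t x) (b y) * b x := by
  classical
  let _ : CommGroup q.ker := { (inferInstance : Group q.ker) with mul_comm := hcomm.is_comm.comm }
  have hβ (x g : G) : t x * t' g * (t' (x * g))⁻¹ ∈ q.ker := by
    simp [MonoidHom.mem_ker, hqt, hqt']
  let β (x g : G) : q.ker := ⟨_, hβ x g⟩
  have hinv (x g g' : G) (h : (g : G ⧸ H) = g') : β x g = β x g' := by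
    obtain ⟨k, rfl⟩ : ∃ k : H, g' = g * k := ⟨⟨_, QuotientGroup.eq.mp h⟩, by simp⟩
    refine Subtype.ext ?_
    change t x * t' g * (t' (x * g))⁻¹ = t x * t' (g * k) * (t' (x * (g * k)))⁻¹
    rw [hts, ← mul_assoc x, hts]
    group
  have hcocycle (x y g : G) :
      a x y * β (x * y) g = MulAut.conjNormal (t x) (β y g) * β x (y * g) := by
    refine Subtype.ext ?_
    rw [Subgroup.coe_mul, Subgroup.coe_mul, MulAut.conjNormal_apply, ha]
    change t x * t y * (t (x * y))⁻¹ * (t (x * y) * t' g * (t' (x * y * g))⁻¹) =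
      t x * (t y * t' g * (t' (y * g))⁻¹) * (t x)⁻¹ * (t x * t' (y * g) * (t' (x * (y * g)))⁻¹)
    rw [← mul_assoc x]
    group
  have : Fintype (G ⧸ H) := Fintype.ofFinite _
  refine ⟨fun x => ∏ c : G ⧸ H, β x c.out, ?_, fun x y => ?_⟩
  · refine continuous_finsetProd _ fun c _ => Continuous.subtype_mk ?_ _
    fun_prop
  · have hre : ∏ c : G ⧸ H, β x c.out = ∏ c : G ⧸ H, β x (y * c.out) := by
      rw [← Equiv.prod_comp (MulAction.toPerm y : Equiv.Perm (G ⧸ H))]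
      refine Finset.prod_congr rfl fun c _ => hinv _ _ _ ?_
      rw [QuotientGroup.out_eq', ← smul_eq_mul, MulAction.toPerm_apply]
      conv_lhs => rw [← QuotientGroup.out_eq' c]
      rfl
    change a x y ^ H.index * (∏ c : G ⧸ H, β (x * y) c.out) =
      MulAut.conjNormal (t x) (∏ c : G ⧸ H, β y c.out) * ∏ c : G ⧸ H, β x c.out
    rw [hre, map_prod, ← Finset.prod_mul_distrib, Subgroup.index, Nat.card_eq_fintype_card,
      ← Finset.card_univ, ← Finset.prod_const, ← Finset.prod_mul_distrib]
    exact Finset.prod_congr rfl fun c _ => hcocycle x y _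

/-- An extension of topological groups with abelian kernel which splits over two open subgroups of
coprime finite indices splits. -/
theorem exists_continuous_section_of_coprime_index [TopologicalSpace E] [IsTopologicalGroup E]
    [TopologicalSpace G] [IsTopologicalGroup G] (hcomm : IsMulCommutative q.ker)
    (H₁ H₂ : Subgroup G) [H₁.FiniteIndex] [H₂.FiniteIndex]
    (h₁ : IsOpen (H₁ : Set G)) (h₂ : IsOpen (H₂ : Set G)) (hcop : H₁.index.Coprime H₂.index)
    (s₁ : H₁ →* E) (hs₁ : Continuous s₁) (hqs₁ : ∀ h, q (s₁ h) = h)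
    (s₂ : H₂ →* E) (hs₂ : Continuous s₂) (hqs₂ : ∀ h, q (s₂ h) = h) :
    ∃ s : G →ₜ* E, ∀ g, q (s g) = g := by
  have hq : Function.Surjective q := by
    have l₁ : H₁ ≤ q.range := fun h hh => ⟨s₁ ⟨h, hh⟩, hqs₁ _⟩
    have l₂ : H₂ ≤ q.range := fun h hh => ⟨s₂ ⟨h, hh⟩, hqs₂ _⟩
    rw [← MonoidHom.range_eq_top, ← Subgroup.index_eq_one]
    exact Nat.eq_one_of_dvd_coprimes hcop (Subgroup.index_dvd_of_le l₁)
      (Subgroup.index_dvd_of_le l₂)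
  obtain ⟨t, ht, hqt, hts₁⟩ := exists_equivariant_section hq H₁ h₁ s₁ hs₁ hqs₁
  obtain ⟨t', ht', hqt', hts₂⟩ := exists_equivariant_section hq H₂ h₂ s₂ hs₂ hqs₂
  let _ : CommGroup q.ker := { (inferInstance : Group q.ker) with mul_comm := hcomm.is_comm.comm }
  let a (x y : G) : q.ker := ⟨t x * t y * (t (x * y))⁻¹, by simp [MonoidHom.mem_ker, hqt]⟩
  obtain ⟨b₁, hb₁, hab₁⟩ := exists_coboundary_pow_index hcomm H₁ s₁ t t ht ht hqt hqt hts₁ a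
    fun _ _ => rfl
  obtain ⟨b₂, hb₂, hab₂⟩ := exists_coboundary_pow_index hcomm H₂ s₂ t t' ht ht' hqt hqt' hts₂ a
    fun _ _ => rfl
  -- With `u d₁ + v d₂ = 1`, the cochain `b₁ ^ u * b₂ ^ v` bounds the cocycle itself.
  obtain ⟨u, v, huv⟩ : IsCoprime (H₁.index : ℤ) H₂.index := Nat.isCoprime_iff_coprime.mpr hcop
  let b (x : G) : q.ker := b₁ x ^ u * b₂ x ^ v
  have hab (x y : G) : a x y * b (x * y) = MulAut.conjNormal (t x) (b y) * b x := by
    have e₁ := congrArg (· ^ u) (hab₁ x y)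
    have e₂ := congrArg (· ^ v) (hab₂ x y)
    simp only [mul_zpow, ← zpow_natCast, ← zpow_mul] at e₁ e₂
    have e₃ : a x y = a x y ^ ((H₁.index : ℤ) * u) * a x y ^ ((H₂.index : ℤ) * v) := by
      rw [← zpow_add, mul_comm _ u, mul_comm _ v, huv, zpow_one]
    simp only [b, map_mul, map_zpow]
    rw [e₃, mul_mul_mul_comm, e₁, e₂]
    exact mul_mul_mul_comm _ _ _ _
  have hb : Continuous b := (hb₁.zpow u).mul (hb₂.zpow v)
  refine ⟨⟨MonoidHom.mk' (fun x => (b x : E)⁻¹ * t x) fun x y => ?_, ?_⟩, fun g => ?_⟩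
  · have h : (t x * t y * (t (x * y))⁻¹) * (b (x * y) : E) = t x * b y * (t x)⁻¹ * b x :=
      congrArg Subtype.val (hab x y)
    have h' : (b (x * y) : E) = t (x * y) * (t y)⁻¹ * (t x)⁻¹ *
        (t x * b y * (t x)⁻¹ * b x) := by
      rw [← h]
      group
    rw [h']
    group
  · exact (hb.subtype_val.inv).mul ht
  · have : q (b g) = 1 := (b g).2
    change q ((b g : E)⁻¹ * t g) = g
    rw [map_mul, map_inv, this, hqt, inv_one, one_mul]

end Splitting

/-! ### Unique lifting of points to finite étale covers -/

section RingLift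

open scoped TensorProduct

variable {R C R' : Type*} [CommRing R] [IsDomain R] [CommRing C] [Algebra R C]
  [CommRing R'] [IsDomain R']

/-- Let `R` be a domain that is integrally closed in an algebraically closed field. Every point of a
finite flat `R`-algebra `C` with values in a domain `R'` over `R` comes from a section `C → R`:
a minimal prime of `C` below the kernel of the point lies over `0`, so its residue ring is `R`. -/
theorem exists_algHom_comp_eq (K : Type*) [Field K] [IsAlgClosed K] [Algebra R K]
    [FaithfulSMul R K] [IsIntegrallyClosedIn R K] [Module.Finite R C] [Module.Flat R C]
    (ρ : R →+* R') (ψ : C →+* R') (h : ψ.comp (algebraMap R C) = ρ) :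
    ∃ φ : C →ₐ[R] R, ρ.comp φ.toRingHom = ψ := by
  have := RingHom.ker_isPrime ψ
  obtain ⟨q, hq, hqψ⟩ := Ideal.exists_minimalPrimes_le (bot_le (a := RingHom.ker ψ))
  have hqp : q.IsPrime := hq.1.1
  have h0 (r : R) (hr : algebraMap R C r ∈ q) : r = 0 := by
    by_contra hr0
    refine Set.disjoint_left.mp (Ideal.disjoint_nonZeroDivisors_of_mem_minimalPrimes hq) hr ?_
    refine mem_nonZeroDivisors_of_injective (f := RingHom.id C) (fun _ _ => id) ?_
    rw [RingHom.id_apply, mem_nonZeroDivisors_iff_right]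
    intro c hc
    refine Module.Flat.isSMulRegular_of_nonZeroDivisors (M := C)
      (mem_nonZeroDivisors_of_ne_zero hr0) ?_
    simp only [Algebra.smul_def, mul_zero]
    rw [mul_comm, hc]
  have hinj : Function.Injective (algebraMap R (C ⧸ q)) := by
    rw [injective_iff_map_eq_zero]
    intro r hr
    exact h0 r (Ideal.Quotient.eq_zero_iff_mem.mp hr)
  have : FaithfulSMul R (C ⧸ q) := (faithfulSMul_iff_algebraMap_injective _ _).mpr hinj
  have : Algebra.IsAlgebraic R (C ⧸ q) := Algebra.IsIntegral.isAlgebraic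
  let θ : C ⧸ q →ₐ[R] K := IsAlgClosed.lift
  have hθ (c : C ⧸ q) (hc : θ c = 0) : c = 0 := by
    by_contra hc0
    obtain ⟨r, hr, d, hd⟩ := (Algebra.IsAlgebraic.isAlgebraic (R := R) c).exists_nonzero_dvd
      (mem_nonZeroDivisors_of_ne_zero hc0)
    have := congrArg θ hd
    rw [map_mul, hc, zero_mul, AlgHom.commutes] at this
    exact hr (FaithfulSMul.algebraMap_injective R K (this.trans (map_zero _).symm))
  have hint (c : C) : ∃ r : R, algebraMap R C r - c ∈ q := by
    obtain ⟨r, hr⟩ := IsIntegrallyClosedIn.algebraMap_eq_of_integral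
      ((Algebra.IsIntegral.isIntegral (R := R) (Ideal.Quotient.mk q c)).map θ)
    refine ⟨r, Ideal.Quotient.eq_zero_iff_mem.mp (hθ _ ?_)⟩
    rw [map_sub, map_sub, ← hr, sub_eq_zero]
    exact θ.commutes r
  choose f hf using hint
  have hf' (c : C) (r : R) (hr : algebraMap R C r - c ∈ q) : f c = r := by
    rw [← sub_eq_zero]
    refine h0 _ ?_
    rw [map_sub]
    simpa using q.sub_mem (hf c) hr
  let φ : C →ₐ[R] R :=
    { toFun := f
      map_one' := hf' _ _ (by simp)
      map_zero' := hf' _ _ (by simp)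
      map_mul' := fun a b => hf' _ _ (by
        have := q.add_mem (q.mul_mem_left (algebraMap R C (f a)) (hf b))
          (q.mul_mem_right b (hf a))
        convert this using 1
        rw [map_mul]; ring)
      map_add' := fun a b => hf' _ _ (by
        convert q.add_mem (hf a) (hf b) using 1
        rw [map_add]; ring)
      commutes' := fun r => hf' _ _ (by simp) }
  refine ⟨φ, RingHom.ext fun c => ?_⟩
  have := hqψ (hf c)
  rw [RingHom.mem_ker, map_sub, sub_eq_zero] at this
  rw [← this, ← h]
  rfl

/-- Two sections of an unramified algebra over a domain `R` agree if they agree at one point of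
`R`. -/
theorem algHom_eq_of_comp_eq [Algebra.FormallyUnramified R C] [Algebra.FiniteType R C]
    (ρ : R →+* R') (φ₁ φ₂ : C →ₐ[R] R)
    (h : ρ.comp φ₁.toRingHom = ρ.comp φ₂.toRingHom) : φ₁ = φ₂ := by
  obtain ⟨t, ht, ht1⟩ := Algebra.FormallyUnramified.iff_exists_tensorProduct (R := R) (S := C).mp
    inferInstance
  let Φ : C ⊗[R] C →ₐ[R] R := Algebra.TensorProduct.lift φ₁ φ₂ fun _ _ => Commute.all _ _
  have hΦ : ρ (Φ t) = 1 := by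
    have h2 : ρ.comp Φ.toRingHom =
        (ρ.comp φ₁.toRingHom).comp (Algebra.TensorProduct.lmul' R (S := C)).toRingHom := by
      refine RingHom.ext fun x => ?_
      induction x with
      | zero => simp
      | add x y hx hy => rw [map_add, hx, hy, map_add]
      | tmul x y =>
        have h3 : ρ (φ₁ y) = ρ (φ₂ y) := RingHom.congr_fun h y
        simp [Φ, h3]
    have := RingHom.congr_fun h2 t
    simpa [ht1] using this
  ext s
  have h3 := congrArg Φ (ht s)
  have h4 : Φ t ≠ 0 := fun h0 => by rw [h0, map_zero] at hΦ; exact zero_ne_one hΦ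
  simp only [map_mul, map_sub, map_zero, mul_eq_zero, h4, or_false, Φ,
    Algebra.TensorProduct.lift_tmul, map_one, one_mul, mul_one] at h3
  exact (sub_eq_zero.mp h3).symm

end RingLift

section SchemeLift

/-- A morphism of schemes `i : S' ⟶ S` has unique lifting if every point `S' ⟶ Y` of a finite étale
cover `Y ⟶ X` over a point `S ⟶ X` extends uniquely to a point `S ⟶ Y`. -/
def UniqueLifting {S S' : Scheme.{u}} (i : S' ⟶ S) : Prop :=
  ∀ ⦃X Y : Scheme.{u}⦄ (g : Y ⟶ X) [IsFinite g] [Etale g] (z : S ⟶ X) (y : S' ⟶ Y),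
    y ≫ g = i ≫ z → ∃! w : S ⟶ Y, w ≫ g = z ∧ i ≫ w = y

/-- Covers of `Spec R` are disjoint unions of copies of `Spec R` if the domain `R` is integrally
closed in an algebraically closed field, so points with values in any domain over `R` extend
uniquely. -/
theorem uniqueLifting_specMap {R R' K : Type u} [CommRing R] [IsDomain R] [CommRing R']
    [IsDomain R'] [Field K] [IsAlgClosed K] [Algebra R K] [FaithfulSMul R K]
    [IsIntegrallyClosedIn R K] (ρ : R →+* R') :
    UniqueLifting (Spec.map (CommRingCat.ofHom ρ)) := by
  -- It suffices to treat sections of covers of `Spec R` itself.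
  suffices H : ∀ {Y : Scheme.{u}} (g : Y ⟶ Spec (.of R)) [IsFinite g] [Etale g]
      (y : Spec (.of R') ⟶ Y), y ≫ g = Spec.map (CommRingCat.ofHom ρ) →
      ∃! w : Spec (.of R) ⟶ Y, w ≫ g = 𝟙 _ ∧ Spec.map (CommRingCat.ofHom ρ) ≫ w = y by
    intro X Y g _ _ z y h
    obtain ⟨w, ⟨hw1, hw2⟩, hw⟩ := H (pullback.snd g z)
      (pullback.lift y (Spec.map (CommRingCat.ofHom ρ)) h) (pullback.lift_snd _ _ _)
    refine ⟨w ≫ pullback.fst _ _, ⟨?_, ?_⟩, ?_⟩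
    · rw [Category.assoc, pullback.condition, reassoc_of% hw1]
    · rw [reassoc_of% hw2, pullback.lift_fst]
    · rintro w' ⟨hw'1, hw'2⟩
      rw [← hw (pullback.lift w' (𝟙 _) (by rw [hw'1, Category.id_comp]))
        ⟨pullback.lift_snd _ _ _, ?_⟩, pullback.lift_fst]
      refine pullback.hom_ext ?_ ?_ <;> rw [Category.assoc]
      · rw [pullback.lift_fst, pullback.lift_fst, hw'2]
      · rw [pullback.lift_snd, pullback.lift_snd, Category.comp_id]
  intro Y g _ _ y h
  have : IsAffine Y := isAffine_of_isAffineHom g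
  let e := Y.isoSpec
  let φ : CommRingCat.of R ⟶ Γ(Y, ⊤) := Spec.preimage (e.inv ≫ g)
  have hφ : Spec.map φ = e.inv ≫ g := Spec.map_preimage _
  algebraize [φ.hom]
  have h1 : IsFinite (Spec.map φ) := by rw [hφ]; infer_instance
  have h2 : Etale (Spec.map φ) := by rw [hφ]; infer_instance
  have : Module.Finite R Γ(Y, ⊤) := IsFinite.SpecMap_iff φ |>.mp h1
  have : Algebra.Etale R Γ(Y, ⊤) := HasRingHomProperty.Spec_iff (P := @Etale) |>.mp h2
  have hy (T : Type u) [CommRing T] (y : Spec (.of T) ⟶ Y) :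
      y ≫ g = Spec.map (φ ≫ Spec.preimage (y ≫ e.hom)) := by
    rw [Spec.map_comp, Spec.map_preimage, hφ]; simp
  have hcomp : φ ≫ Spec.preimage (y ≫ e.hom) = CommRingCat.ofHom ρ :=
    Spec.map_injective ((hy _ y).symm.trans h)
  obtain ⟨s, hs⟩ := exists_algHom_comp_eq K ρ (Spec.preimage (y ≫ e.hom)).hom
    (congrArg CommRingCat.Hom.hom hcomp)
  have hsφ : φ ≫ CommRingCat.ofHom s.toRingHom = 𝟙 _ := by
    ext r; exact s.commutes r
  refine ⟨Spec.map (CommRingCat.ofHom s.toRingHom) ≫ e.inv, ⟨?_, ?_⟩, ?_⟩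
  · rw [Category.assoc, ← hφ, ← Spec.map_comp, hsφ, Spec.map_id]
  · rw [← Category.assoc, Iso.comp_inv_eq, ← Spec.map_comp, ← Spec.map_preimage (y ≫ e.hom)]
    congr 1
    ext c
    exact RingHom.congr_fun hs c
  · rintro w ⟨hw1, hw2⟩
    have h3 : φ ≫ Spec.preimage (w ≫ e.hom) = 𝟙 _ :=
      Spec.map_injective (by rw [← hy, hw1, Spec.map_id])
    let s' : Γ(Y, ⊤) →ₐ[R] R :=
      { (Spec.preimage (w ≫ e.hom)).hom with
        commutes' := fun r => ConcreteCategory.congr_hom h3 r }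
    have h4 : s' = s := by
      refine algHom_eq_of_comp_eq ρ s' s ?_
      rw [hs]
      have h5 : Spec.preimage (w ≫ e.hom) ≫ CommRingCat.ofHom ρ = Spec.preimage (y ≫ e.hom) :=
        Spec.map_injective (by
          rw [Spec.map_comp, Spec.map_preimage, Spec.map_preimage, reassoc_of% hw2])
      exact congrArg CommRingCat.Hom.hom h5
    rw [← h4, Iso.eq_comp_inv]
    exact (Spec.map_preimage _).symm

end SchemeLift

/-! ### Group actions on fibre functors -/

section Pi1Construct

variable {Ω : Type u} [Field Ω] {X : Scheme.{u}} {η : Spec (.of Ω) ⟶ X}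

theorem Pi1.ext_smul {σ τ : Pi1 η} (h : ∀ (Y : FinEtCover X) (y : GeomFiber η Y), σ • y = τ • y) :
    σ = τ :=
  Iso.ext (NatTrans.ext (funext fun Y => FintypeCat.hom_ext _ _ fun y => h Y y))

/-- A compatible family of actions of a group on the fibres over `η` is a homomorphism to
`π₁(X, η)`. -/
noncomputable def Pi1.ofPerm {Δ : Type*} [Group Δ]
    (a : ∀ Y : FinEtCover X, Δ →* Equiv.Perm (GeomFiber η Y))
    (ha : ∀ (g : Δ) {Y Z : FinEtCover X} (f : Y ⟶ Z) (y : GeomFiber η Y),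
      a Z g (GeomFiber.map η f y) = GeomFiber.map η f (a Y g y)) : Δ →* Pi1 η where
  toFun g := NatIso.ofComponents
    (fun Y => FintypeCat.equivEquivIso (A := FintypeCat.of _) (B := FintypeCat.of _) (a Y g))
    (fun f => FintypeCat.hom_ext _ _ fun y => ha g f y)
  map_one' := Pi1.ext_smul fun Y y => DFunLike.congr_fun (map_one (a Y)) y
  map_mul' g h := Pi1.ext_smul fun Y y => DFunLike.congr_fun (map_mul (a Y) g h) y

open PreGaloisCategory in
/-- A homomorphism to `π₁(X, η)` is continuous if the stabilizers of the points of the fibres of all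
covers are open. -/
theorem Pi1.continuous_of_stabilizer {Δ : Type*} [Group Δ] [TopologicalSpace Δ]
    [IsTopologicalGroup Δ] (s : Δ →* Pi1 η)
    (hs : ∀ (Y : FinEtCover X) (y : GeomFiber η Y), {g | s g • y = y} ∈ nhds (1 : Δ)) :
    Continuous s := by
  refine continuous_of_continuousAt_one _ ?_
  rw [ContinuousAt, (Topology.IsInducing.induced (autEmbedding (fiberFunctor η))).tendsto_nhds_iff,
    tendsto_pi_nhds]
  intro Y
  rw [nhds_discrete (Aut ((fiberFunctor η).obj Y)), Filter.tendsto_pure]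
  have := Filter.iInter_mem.mpr (hs Y)
  filter_upwards [this] with g hg
  refine Iso.ext (FintypeCat.hom_ext _ _ fun y => ?_)
  rw [map_one]
  exact Set.mem_iInter.mp hg y

end Pi1Construct

section LiftingAction

variable {Ω : Type u} [Field Ω] {X : Scheme.{u}}

/-- A point `z : S ⟶ X` through which the geometric point `η` factors by a morphism with unique
lifting, and another point `S' ⟶ S ⟶ X` specializing `z` with unique lifting, with a group `Δ`
acting on `S'` over `X`. The fibre over `η` of a cover of `X` is then its set of `S'`-points over
`X`, and `Δ` acts on it. As `act g` is to be `Spec` of a left action on a ring, `act` turns products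
into compositions in the order of `≫`. -/
structure LiftingAction (η : Spec (.of Ω) ⟶ X) (Δ : Type*) [Group Δ] where
  {S S' : Scheme.{u}}
  p : Spec (.of Ω) ⟶ S
  r : S' ⟶ S
  z : S ⟶ X
  uniqueLifting_p : UniqueLifting p
  uniqueLifting_r : UniqueLifting r
  w : p ≫ z = η
  act : Δ → (S' ⟶ S')
  act_one : act 1 = 𝟙 S'
  act_mul (g h : Δ) : act (g * h) = act g ≫ act h
  act_w (g : Δ) : act g ≫ r ≫ z = r ≫ z

namespace LiftingAction

variable {η : Spec (.of Ω) ⟶ X} {Δ : Type*} [Group Δ] (D : LiftingAction η Δ)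

/-- The points `y` and `y'` of the fibre over `η` extend to `S`-points of `Y` whose restrictions to
`S'` correspond under `g`. -/
def Rel (g : Δ) {Y : FinEtCover X} (y y' : GeomFiber η Y) : Prop :=
  ∃ v v' : D.S ⟶ Y.left, v ≫ Y.hom = D.z ∧ v' ≫ Y.hom = D.z ∧ D.p ≫ v = y.pt ∧ D.p ≫ v' = y'.pt ∧
    D.r ≫ v' = D.act g ≫ D.r ≫ v

theorem existsUnique_rel (g : Δ) {Y : FinEtCover X} (y : GeomFiber η Y) :
    ∃! y' : GeomFiber η Y, D.Rel g y y' := by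
  obtain ⟨v, ⟨hv1, hv2⟩, hv⟩ := D.uniqueLifting_p Y.hom D.z y.pt (y.w.trans D.w.symm)
  obtain ⟨v', ⟨hv'1, hv'2⟩, hv'⟩ := D.uniqueLifting_r Y.hom D.z (D.act g ≫ D.r ≫ v) (by
    rw [Category.assoc, Category.assoc, hv1, D.act_w])
  refine ⟨⟨D.p ≫ v', by rw [Category.assoc, hv'1, D.w]⟩, ⟨v, v', hv1, hv'1, hv2, rfl, hv'2⟩, ?_⟩
  rintro y' ⟨u, u', hu1, hu'1, hu2, hu'2, h⟩
  obtain rfl := hv u ⟨hu1, hu2⟩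
  obtain rfl := hv' u' ⟨hu'1, h⟩
  exact GeomFiber.ext hu'2.symm

variable {D} in
theorem Rel.map {g : Δ} {Y Z : FinEtCover X} {y y' : GeomFiber η Y} (h : D.Rel g y y') (f : Y ⟶ Z) :
    D.Rel g (GeomFiber.map η f y) (GeomFiber.map η f y') := by
  obtain ⟨v, v', h1, h2, h3, h4, h5⟩ := h
  refine ⟨v ≫ f.left, v' ≫ f.left, ?_, ?_, ?_, ?_, ?_⟩
  · rw [Category.assoc, f.w, h1]
  · rw [Category.assoc, f.w, h2]
  · rw [← Category.assoc, h3]; rfl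
  · rw [← Category.assoc, h4]; rfl
  · rw [← Category.assoc, h5]; simp only [Category.assoc]

theorem rel_one {Y : FinEtCover X} (y : GeomFiber η Y) : D.Rel 1 y y := by
  obtain ⟨v, ⟨hv1, hv2⟩, -⟩ := D.uniqueLifting_p Y.hom D.z y.pt (y.w.trans D.w.symm)
  exact ⟨v, v, hv1, hv1, hv2, hv2, by rw [D.act_one, Category.id_comp]⟩

variable {D} in
theorem Rel.mul {g h : Δ} {Y : FinEtCover X} {y y' y'' : GeomFiber η Y}
    (h₁ : D.Rel h y y') (h₂ : D.Rel g y' y'') : D.Rel (g * h) y y'' := by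
  obtain ⟨v, v', h1, h2, h3, h4, h5⟩ := h₁
  obtain ⟨w, w', k1, k2, k3, k4, k5⟩ := h₂
  obtain rfl : v' = w := by
    obtain ⟨_, -, hu⟩ := D.uniqueLifting_p Y.hom D.z y'.pt (y'.w.trans D.w.symm)
    rw [hu v' ⟨h2, h4⟩, hu w ⟨k1, k3⟩]
  exact ⟨v, w', h1, k2, h3, k4, by rw [k5, h5, D.act_mul, Category.assoc]⟩

/-- The bijection of the fibre over `η` of the cover `Y` given by an element of `Δ`. -/
noncomputable def move (g : Δ) (Y : FinEtCover X) (y : GeomFiber η Y) : GeomFiber η Y :=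
  (D.existsUnique_rel g y).choose

theorem rel_move (g : Δ) (Y : FinEtCover X) (y : GeomFiber η Y) : D.Rel g y (D.move g Y y) :=
  (D.existsUnique_rel g y).choose_spec.1

variable {D} in
theorem Rel.eq_move {g : Δ} {Y : FinEtCover X} {y y' : GeomFiber η Y} (h : D.Rel g y y') :
    D.move g Y y = y' :=
  (D.existsUnique_rel g y).unique (D.rel_move g Y y) h

/-- The homomorphism `Δ → π₁(X, η)` given by the action of `Δ` on the fibres over `η`. -/
noncomputable def toPi1 : Δ →* Pi1 η :=
  Pi1.ofPerm (fun Y => MonoidHom.toHomPerm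
    { toFun := fun g => D.move g Y
      map_one' := funext fun y => (D.rel_one y).eq_move
      map_mul' := fun g h => funext fun y =>
        ((D.rel_move h Y y).mul (D.rel_move g Y _)).eq_move })
    fun g _ _ f y => ((D.rel_move g _ y).map f).eq_move

theorem rel_iff {g : Δ} {Y : FinEtCover X} {y y' : GeomFiber η Y} :
    D.Rel g y y' ↔ D.toPi1 g • y = y' :=
  ⟨fun h => h.eq_move, fun h => h ▸ D.rel_move g Y y⟩

/-- The data `D`, pushed forward along `f : X ⟶ X'`. -/
def push {X' : Scheme.{u}} (f : X ⟶ X') {η' : Spec (.of Ω) ⟶ X'} (hf : η ≫ f = η') :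
    LiftingAction η' Δ where
  p := D.p
  r := D.r
  z := D.z ≫ f
  uniqueLifting_p := D.uniqueLifting_p
  uniqueLifting_r := D.uniqueLifting_r
  w := by rw [← Category.assoc, D.w, hf]
  act := D.act
  act_one := D.act_one
  act_mul := D.act_mul
  act_w g := by
    have := congrArg (· ≫ f) (D.act_w g)
    simpa using this

theorem map_toPi1 {X' : Scheme.{u}} (f : X ⟶ X') {η' : Spec (.of Ω) ⟶ X'} (hf : η ≫ f = η')
    (g : Δ) : Pi1.map f η η' hf (D.toPi1 g) = (D.push f hf).toPi1 g := by
  refine Pi1.ext_smul fun Y y => ?_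
  rw [Pi1.map_smul]
  symm
  rw [← rel_iff]
  obtain ⟨v, v', h1, h2, h3, h4, h5⟩ :=
    D.rel_move g (Y.pullbackObj f) ((fiberBaseChange f η η' hf Y).symm y)
  refine ⟨v ≫ pullback.fst _ _, v' ≫ pullback.fst _ _, ?_, ?_, ?_, ?_, ?_⟩
  · exact (Category.assoc _ _ _).trans ((congrArg (v ≫ ·) pullback.condition).trans
      ((Category.assoc _ _ _).symm.trans (congrArg (· ≫ f) h1)))
  · exact (Category.assoc _ _ _).trans ((congrArg (v' ≫ ·) pullback.condition).trans
      ((Category.assoc _ _ _).symm.trans (congrArg (· ≫ f) h2)))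
  · change D.p ≫ v ≫ _ = _
    rw [← Category.assoc, h3]
    exact pullback.lift_fst _ _ _
  · change D.p ≫ v' ≫ _ = _
    rw [← Category.assoc, h4]
    rfl
  · change D.r ≫ v' ≫ _ = D.act g ≫ D.r ≫ v ≫ _
    rw [← Category.assoc, h5]
    simp only [Category.assoc]

end LiftingAction

end LiftingAction

/-! ### Étale algebras over normal domains -/

section NormalDomain

open scoped TensorProduct

/-- A homomorphism from `B` to an algebraically closed field extends to every integral extension of
`B`. -/
theorem exists_ringHom_comp_algebraMap_eq {B S Ω : Type*} [CommRing B] [CommRing S] [Algebra B S]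
    [FaithfulSMul B S] [Algebra.IsIntegral B S] [Field Ω] [IsAlgClosed Ω] (f : B →+* Ω) :
    ∃ g : S →+* Ω, g.comp (algebraMap B S) = f := by
  have := RingHom.ker_isPrime f
  obtain ⟨Q, -, hQ, hQf⟩ := Ideal.exists_ideal_over_prime_of_isIntegral (S := S) (RingHom.ker f) ⊥
    (by
      rw [← RingHom.ker_eq_comap_bot, (RingHom.injective_iff_ker_eq_bot _).mp
        (FaithfulSMul.algebraMap_injective B S)]
      exact bot_le)
  have : Q.LiesOver (RingHom.ker f) := ⟨hQf.symm⟩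
  let _ : Algebra (B ⧸ RingHom.ker f) Ω := (RingHom.kerLift f).toAlgebra
  have : Module.IsTorsionFree (B ⧸ RingHom.ker f) Ω :=
    Module.isTorsionFree_iff_algebraMap_injective.mpr (RingHom.kerLift_injective f)
  have : Module.IsTorsionFree (B ⧸ RingHom.ker f) (S ⧸ Q) := by
    rw [Module.isTorsionFree_iff_algebraMap_injective, injective_iff_map_eq_zero]
    rintro ⟨b⟩ hb
    have h : algebraMap B S b ∈ Q := Ideal.Quotient.eq_zero_iff_mem.mp hb
    exact Ideal.Quotient.eq_zero_iff_mem.mpr (hQf.le h)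
  have : Algebra.IsIntegral (B ⧸ RingHom.ker f) (S ⧸ Q) := inferInstance
  have : Algebra.IsAlgebraic (B ⧸ RingHom.ker f) (S ⧸ Q) := Algebra.IsIntegral.isAlgebraic
  let θ : S ⧸ Q →ₐ[B ⧸ RingHom.ker f] Ω := IsAlgClosed.lift
  exact ⟨θ.toRingHom.comp (Ideal.Quotient.mk Q), RingHom.ext fun b =>
    θ.commutes (Ideal.Quotient.mk _ b)⟩

variable {B M : Type*} [CommRing B] [IsIntegrallyClosed B] [Field M] [Algebra B M]
  [IsFractionRing B M] {C : Type*} [CommRing C] [Algebra B C]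

/-- An étale algebra `C` over a normal domain `B` is integrally closed in its generic fibre, so it
contains the idempotents of the generic fibre. -/
theorem exists_idempotent_tmul_one_eq [Algebra.Etale B C] (e : C ⊗[B] M)
    (he : IsIdempotentElem e) : ∃ c : C, IsIdempotentElem c ∧ c ⊗ₜ 1 = e := by
  have hint : IsIntegral C e := by
    refine ⟨Polynomial.X ^ 2 - Polynomial.X, Polynomial.monic_X_pow_sub
      (Polynomial.degree_X_le.trans_lt (by norm_num)), ?_⟩
    simp [sq, he.eq]
  obtain ⟨x, hx⟩ := (TensorProduct.toIntegralClosure_bijective_of_smooth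
    (R := B) (S := C) (B := M)).2 ⟨e, hint⟩
  have hx' : Algebra.TensorProduct.map (.id C C) (integralClosure B M).val x = e :=
    congrArg Subtype.val hx
  have hc : ∃ c : C, c ⊗ₜ 1 = e := by
    rw [← hx']
    clear hx hx'
    induction x with
    | zero => exact ⟨0, by simp⟩
    | add x y hx hy =>
      obtain ⟨a, ha⟩ := hx
      obtain ⟨b, hb⟩ := hy
      exact ⟨a + b, by rw [TensorProduct.add_tmul, ha, hb, map_add]⟩
    | tmul x y =>
      obtain ⟨b, hb⟩ := IsIntegrallyClosed.isIntegral_iff.mp y.2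
      refine ⟨b • x, ?_⟩
      rw [TensorProduct.smul_tmul, Algebra.smul_def, hb, mul_one]
      simp
  obtain ⟨c, hc⟩ := hc
  refine ⟨c, ?_, hc⟩
  have hinj : Function.Injective (Algebra.TensorProduct.includeLeft : C →ₐ[B] C ⊗[B] M) :=
    Algebra.TensorProduct.includeLeft_injective (IsFractionRing.injective B M)
  refine hinj ?_
  rw [map_mul, Algebra.TensorProduct.includeLeft_apply, hc, he]

variable {N : Type*} [Field N] [Algebra M N] [Algebra B N] [IsScalarTower B M N]

/-- Two points `φ`, `ψ` of a finite étale algebra over a normal domain with values in an extension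
of the fraction field have the same kernel if they lie on the same connected component. -/
theorem ker_lift_le_ker_lift [Algebra.Etale B C] [Module.Finite B C] (φ ψ : C →ₐ[B] N)
    (h : ∀ c, IsIdempotentElem c → φ c = 0 → ψ c = 0) (x : C ⊗[B] M)
    (hx : Algebra.TensorProduct.lift φ (IsScalarTower.toAlgHom B M N) (fun _ _ => .all _ _) x = 0) :
    Algebra.TensorProduct.lift ψ (IsScalarTower.toAlgHom B M N) (fun _ _ => .all _ _) x = 0 := by
  set Φ := Algebra.TensorProduct.lift φ (IsScalarTower.toAlgHom B M N) (fun _ _ => .all _ _)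
  set Ψ := Algebra.TensorProduct.lift ψ (IsScalarTower.toAlgHom B M N) (fun _ _ => .all _ _)
  have : IsArtinianRing (M ⊗[B] C) := IsArtinianRing.of_finite M _
  have : IsArtinianRing (C ⊗[B] M) :=
    (Algebra.TensorProduct.comm B M C).surjective.isArtinianRing
  -- A high power of the maximal ideal `ker Φ` is generated by an idempotent.
  obtain ⟨n, hn⟩ := IsArtinian.monotone_stabilizes
    (⟨fun n => OrderDual.toDual (RingHom.ker Φ ^ n), fun _ _ h => Ideal.pow_le_pow_right h⟩ :
      ℕ →o (Ideal (C ⊗[B] M))ᵒᵈ)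
  have hn' (m : ℕ) (hm : n ≤ m) : RingHom.ker Φ ^ n = RingHom.ker Φ ^ m := hn m hm
  have hid : IsIdempotentElem (RingHom.ker Φ ^ (n + 1)) := by
    rw [IsIdempotentElem, ← pow_add, ← hn' (n + 1) (by omega), ← hn' _ (by omega)]
  obtain ⟨e, he, hke⟩ := (Ideal.isIdempotentElem_iff_of_fg _
    (IsNoetherian.noetherian (RingHom.ker Φ ^ (n + 1)))).mp hid
  obtain ⟨c, hc, rfl⟩ := exists_idempotent_tmul_one_eq e he
  have hφc : φ c = 0 := by
    have : c ⊗ₜ[B] (1 : M) ∈ RingHom.ker Φ :=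
      Ideal.pow_le_self n.succ_ne_zero (hke ▸ Ideal.mem_span_singleton_self _)
    simpa [Φ] using this
  have hψc := h c hc hφc
  obtain ⟨y, hy⟩ : c ⊗ₜ[B] (1 : M) ∣ x ^ (n + 1) := by
    rw [← Ideal.mem_span_singleton]
    exact hke.le (Ideal.pow_mem_pow (show x ∈ RingHom.ker Φ from hx) _)
  have := congrArg Ψ hy
  rw [map_pow, map_mul] at this
  refine pow_eq_zero_iff n.succ_ne_zero |>.mp (this.trans ?_)
  simp [Ψ, hψc]

/-- The Galois group of the generic point acts transitively on the geometric points in a connected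
component of a finite étale algebra over a normal domain. -/
theorem exists_algEquiv_comp_eq [IsAlgClosed N] [Algebra.IsAlgebraic M N] [Algebra.Etale B C]
    [Module.Finite B C] (φ ψ : C →ₐ[B] N)
    (h : ∀ c, IsIdempotentElem c → φ c = 0 → ψ c = 0) : ∃ g : Gal(N/M), ∀ c, g (φ c) = ψ c := by
  let Φ : M ⊗[B] C →ₐ[M] N := Algebra.TensorProduct.lift (Algebra.ofId M N) φ fun _ _ => .all _ _
  let Ψ : M ⊗[B] C →ₐ[M] N := Algebra.TensorProduct.lift (Algebra.ofId M N) ψ fun _ _ => .all _ _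
  have hcomm (φ : C →ₐ[B] N) (x : M ⊗[B] C) :
      Algebra.TensorProduct.lift (Algebra.ofId M N) φ (fun _ _ => .all _ _) x =
      Algebra.TensorProduct.lift φ (IsScalarTower.toAlgHom B M N) (fun _ _ => .all _ _)
        (Algebra.TensorProduct.comm B M C x) := by
    induction x with
    | zero => simp
    | add x y hx hy => simp only [map_add, hx, hy]
    | tmul x y => simp [Algebra.ofId_apply, mul_comm]
  have hker (x : M ⊗[B] C) (hx : Φ x = 0) : Ψ x = 0 := by
    rw [hcomm] at hx ⊢
    exact ker_lift_le_ker_lift φ ψ h _ hx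
  have : Algebra.IsAlgebraic M Φ.range :=
    Algebra.IsAlgebraic.of_injective Φ.range.val Subtype.val_injective
  let L : IntermediateField M N := Algebra.IsAlgebraic.toIntermediateField Φ.range
  let θ : L →ₐ[M] N := (Ideal.Quotient.liftₐ (RingHom.ker Φ) Ψ hker).comp
    (Ideal.quotientKerEquivRange Φ).symm.toAlgHom
  have hθ (x : M ⊗[B] C) : θ ⟨Φ x, x, rfl⟩ = Ψ x := by
    have : (Ideal.quotientKerEquivRange Φ).symm ⟨Φ x, x, rfl⟩ = Ideal.Quotient.mk _ x := by
      rw [AlgEquiv.symm_apply_eq]; rfl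
    change Ideal.Quotient.liftₐ (RingHom.ker Φ) Ψ hker
      ((Ideal.quotientKerEquivRange Φ).symm ⟨Φ x, x, rfl⟩) = _
    rw [this]; rfl
  obtain ⟨g, hg⟩ := IsAlgClosed.surjective_domRestrict_of_isAlgebraic (E := N) θ
  refine ⟨AlgEquiv.ofBijective g (Algebra.IsAlgebraic.algHom_bijective g), fun c => ?_⟩
  have h1 : Φ (1 ⊗ₜ c) = φ c := by simp [Φ]
  have h2 : Ψ (1 ⊗ₜ c) = ψ c := by simp [Ψ]
  rw [← h1, ← h2, ← hθ]
  exact DFunLike.congr_fun hg (⟨Φ (1 ⊗ₜ c), _, rfl⟩ : L)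

end NormalDomain

/-! ### Actions on rings and the map to the Galois group -/

section RingAction

variable {Ω R T : Type u} [Field Ω] [CommRing R] [CommRing T] {X : Scheme.{u}}
  {η : Spec (.of Ω) ⟶ X} {Δ : Type*} [Group Δ]

/-- The `LiftingAction` given by ring homomorphisms `ρ : R → Ω` and `r : R → T` and an action of `Δ`
on `T`. -/
noncomputable abbrev LiftingAction.ofRing (z : Spec (.of R) ⟶ X) (ρ : R →+* Ω) (r : R →+* T)
    (hρ : UniqueLifting (Spec.map (CommRingCat.ofHom ρ)))
    (hr : UniqueLifting (Spec.map (CommRingCat.ofHom r)))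
    (w : Spec.map (CommRingCat.ofHom ρ) ≫ z = η) (a : Δ →* (T →+* T))
    (ha : ∀ g, Spec.map (CommRingCat.ofHom (a g)) ≫ Spec.map (CommRingCat.ofHom r) ≫ z =
      Spec.map (CommRingCat.ofHom r) ≫ z) : LiftingAction η Δ where
  p := Spec.map (CommRingCat.ofHom ρ)
  r := Spec.map (CommRingCat.ofHom r)
  z := z
  uniqueLifting_p := hρ
  uniqueLifting_r := hr
  w := w
  act g := Spec.map (CommRingCat.ofHom (a g))
  act_one := by rw [map_one]; exact Spec.map_id _
  act_mul g h := by rw [map_mul]; exact Spec.map_comp _ _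
  act_w := ha

/-- A point of a finite `B`-algebra with values in `T` is fixed by an endomorphism of `T` over `B`
as soon as the endomorphism fixes the images of finitely many generators. -/
theorem exists_finset_forall_comp_eq {B : Type u} [CommRing B] {Y : Scheme.{u}}
    (f : Y ⟶ Spec (.of B)) [IsFinite f] (x : Spec (.of T) ⟶ Y) :
    ∃ s : Finset T, ∀ a : T →+* T, (∀ t ∈ s, a t = t) →
      Spec.map (CommRingCat.ofHom a) ≫ x ≫ f = x ≫ f → Spec.map (CommRingCat.ofHom a) ≫ x = x := by
  classical
  have : IsAffine Y := isAffine_of_isAffineHom f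
  let e := Y.isoSpec
  let φ : CommRingCat.of B ⟶ Γ(Y, ⊤) := Spec.preimage (e.inv ≫ f)
  have hφ : Spec.map φ = e.inv ≫ f := Spec.map_preimage _
  algebraize [φ.hom]
  have h1 : IsFinite (Spec.map φ) := by rw [hφ]; infer_instance
  have : Module.Finite B Γ(Y, ⊤) := IsFinite.SpecMap_iff φ |>.mp h1
  obtain ⟨s, hs⟩ := Module.Finite.fg_top (R := B) (M := Γ(Y, ⊤))
  let ψ := Spec.preimage (x ≫ e.hom)
  have hψ : Spec.map ψ = x ≫ e.hom := Spec.map_preimage _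
  have hψf : Spec.map (φ ≫ ψ) = x ≫ f := by rw [Spec.map_comp, hψ, hφ]; simp
  refine ⟨s.image ψ.hom, fun a ha hax => ?_⟩
  have hB : φ ≫ ψ ≫ CommRingCat.ofHom a = φ ≫ ψ := by
    apply Spec.map_injective
    rw [hψf, ← hax, ← Category.assoc, Spec.map_comp, hψf]
  have hB' (b : B) : a (ψ.hom (algebraMap B Γ(Y, ⊤) b)) = ψ.hom (algebraMap B Γ(Y, ⊤) b) :=
    ConcreteCategory.congr_hom hB b
  have key : ψ ≫ CommRingCat.ofHom a = ψ := by
    ext c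
    have hc : c ∈ Submodule.span B (s : Set Γ(Y, ⊤)) := hs ▸ Submodule.mem_top
    change a (ψ.hom c) = ψ.hom c
    induction hc using Submodule.span_induction with
    | mem c hc => exact ha _ (Finset.mem_image_of_mem _ hc)
    | zero => simp
    | add c d _ _ hc hd => simp only [map_add, hc, hd]
    | smul b c _ hc => simp only [Algebra.smul_def, map_mul, hc, hB']
  rw [← cancel_mono e.hom, Category.assoc, ← hψ, ← Spec.map_comp, key]

/-- If every element of `T` has an open stabilizer in `Δ`, then `Δ → π₁(Spec B, η)` is
continuous. -/
theorem LiftingAction.continuous_toPi1_ofRing {B : Type u} [CommRing B]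
    {η : Spec (.of Ω) ⟶ Spec (.of B)} [TopologicalSpace Δ] [IsTopologicalGroup Δ]
    (z : Spec (.of R) ⟶ Spec (.of B)) (ρ : R →+* Ω) (r : R →+* T)
    (hρ hr w) (a : Δ →* (T →+* T)) (ha) (hcont : ∀ t, {g | a g t = t} ∈ nhds (1 : Δ)) :
    Continuous (LiftingAction.ofRing (η := η) z ρ r hρ hr w a ha).toPi1 := by
  refine Pi1.continuous_of_stabilizer _ fun Y y => ?_
  obtain ⟨v, ⟨hv1, hv2⟩, -⟩ := hρ Y.hom z y.pt (y.w.trans w.symm)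
  obtain ⟨s, hs⟩ := exists_finset_forall_comp_eq Y.hom (Spec.map (CommRingCat.ofHom r) ≫ v)
  filter_upwards [(Filter.biInter_finset_mem s).mpr fun t _ => hcont t] with g hg
  refine (LiftingAction.rel_iff _).mp ⟨v, v, hv1, hv1, hv2, hv2, (hs (a g) ?_ ?_).symm⟩
  · intro t ht
    exact Set.mem_iInter₂.mp hg t ht
  · rw [Category.assoc, hv1, ha]

variable {k : Type u} [Field k] [CharZero k] [Algebra k Ω] [Algebra k R]
  (z : Spec (.of R) ⟶ Spec (.of k)) (hz : z = Spec.map (CommRingCat.ofHom (algebraMap k R)))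
  (ρ : R →+* Ω) (r : R →+* T) (hρ : UniqueLifting (Spec.map (CommRingCat.ofHom ρ)))
  (hr : UniqueLifting (Spec.map (CommRingCat.ofHom r)))
  (w : Spec.map (CommRingCat.ofHom ρ) ≫ z = specAlg k Ω) (a : Δ →* (T →+* T))
  (ha : ∀ g, Spec.map (CommRingCat.ofHom (a g)) ≫ Spec.map (CommRingCat.ofHom r) ≫ z =
      Spec.map (CommRingCat.ofHom r) ≫ z)
  (j : algebraicClosure k Ω →ₐ[k] R) (hj : ∀ x, ρ (j x) = x)

section

variable {L : Type u} [Field L] [Algebra k L] [FiniteDimensional k L]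

include hz hj

/-- A point `φ : L → k̄ ⊆ Ω` of the cover `Spec L` of `Spec k` extends to `R` through the chosen
embedding `j` of `k̄` in `R`. -/
theorem lift_fieldPoint (φ : L →ₐ[k] algebraicClosure k Ω) :
    Spec.map (CommRingCat.ofHom (j.comp φ).toRingHom) ≫ (fieldCover k L).hom = z ∧
    Spec.map (CommRingCat.ofHom ρ) ≫ Spec.map (CommRingCat.ofHom (j.comp φ).toRingHom) =
      (fieldPoint ((algebraicClosure k Ω).val.comp φ)).pt := by
  constructor
  · refine ((Spec.map_comp _ _).symm.trans (congrArg Spec.map ?_)).trans hz.symm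
    ext x
    exact (j.comp φ).commutes x
  · refine (Spec.map_comp _ _).symm.trans (congrArg Spec.map ?_)
    ext x
    exact hj (φ x)

/-- If `g` acts on the image of `k̄` in `T` as `τ ∈ Gal(k̄ / k)`, then `τ` is the image of `g` in
the Galois group. -/
theorem toGal_toPi1_ofRing (g : Δ) (τ : Gal(algebraicClosure k Ω/k))
    (h : ∀ x, a g (r (j x)) = r (j (τ x))) :
    toGal ((LiftingAction.ofRing z ρ r hρ hr w a ha).toPi1 g) = τ := by
  refine AlgEquiv.ext fun x => Subtype.ext ?_
  let i : IntermediateField.adjoin k {(x : Ω)} →ₐ[k] algebraicClosure k Ω :=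
    IntermediateField.inclusion (IntermediateField.adjoin_simple_le_iff.mpr x.2)
  refine (toGal_apply _ ((algebraicClosure k Ω).val.comp i)
    (IntermediateField.AdjoinSimple.gen k (x : Ω)) x.2).trans ?_
  have : (LiftingAction.ofRing z ρ r hρ hr w a ha).toPi1 g •
      fieldPoint ((algebraicClosure k Ω).val.comp i) =
      fieldPoint ((algebraicClosure k Ω).val.comp (τ.toAlgHom.comp i)) := by
    rw [← LiftingAction.rel_iff]
    refine ⟨_, _, (lift_fieldPoint z hz ρ j hj _).1, (lift_fieldPoint z hz ρ j hj _).1,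
      (lift_fieldPoint z hz ρ j hj _).2, (lift_fieldPoint z hz ρ j hj _).2, ?_⟩
    refine (Spec.map_comp _ _).symm.trans (Eq.trans (congrArg Spec.map ?_)
      ((Spec.map_comp _ _).trans (congrArg (_ ≫ ·) (Spec.map_comp _ _))))
    ext y
    exact (h (i y)).symm
  rw [this, Equiv.symm_apply_apply]
  rfl

/-- An element `g` with trivial image in `Gal(k̄ / k)` fixes the image of `k̄` in `T`. -/
theorem apply_eq_of_toGal_toPi1_ofRing_eq_one (g : Δ)
    (h : toGal ((LiftingAction.ofRing z ρ r hρ hr w a ha).toPi1 g) = 1)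
    (x : algebraicClosure k Ω) : a g (r (j x)) = r (j x) := by
  let i : IntermediateField.adjoin k {(x : Ω)} →ₐ[k] algebraicClosure k Ω :=
    IntermediateField.inclusion (IntermediateField.adjoin_simple_le_iff.mpr x.2)
  have h1 : (LiftingAction.ofRing z ρ r hρ hr w a ha).toPi1 g •
      fieldPoint ((algebraicClosure k Ω).val.comp i) =
      fieldPoint ((algebraicClosure k Ω).val.comp i) := by
    rw [← Equiv.symm_apply_eq]
    refine AlgHom.ext fun l => ?_
    refine (toGal_apply _ ((algebraicClosure k Ω).val.comp i) l (i l).2).symm.trans ?_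
    rw [h]
    rfl
  rw [← LiftingAction.rel_iff] at h1
  obtain ⟨v, v', hv1, hv'1, hv2, hv'2, hvv⟩ := h1
  obtain ⟨_, -, hu⟩ := hρ (fieldCover k (IntermediateField.adjoin k {(x : Ω)})).hom z
    (fieldPoint ((algebraicClosure k Ω).val.comp i)).pt ((fieldPoint _).w.trans w.symm)
  have e := lift_fieldPoint z hz ρ j hj i
  obtain rfl := (hu v ⟨hv1, hv2⟩).trans (hu _ e).symm
  obtain rfl := (hu v' ⟨hv'1, hv'2⟩).trans (hu _ e).symm
  have h2 : CommRingCat.ofHom (j.comp i).toRingHom ≫ CommRingCat.ofHom r =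
      (CommRingCat.ofHom (j.comp i).toRingHom ≫ CommRingCat.ofHom r) ≫ CommRingCat.ofHom (a g) := by
    apply Spec.map_injective
    refine (Spec.map_comp _ _).trans (hvv.trans ?_)
    refine Eq.trans ?_ (Spec.map_comp _ _).symm
    exact congrArg (_ ≫ ·) (Spec.map_comp _ _).symm
  exact (ConcreteCategory.congr_hom h2 (IntermediateField.AdjoinSimple.gen k (x : Ω))).symm

end

end RingAction

/-! ### Sections from points with values in finite extensions -/

section Embedding

variable {k Ω : Type u} [Field k] [Field Ω] [Algebra k Ω]

/-- If the `k`-algebra `R` is integrally closed in an algebraically closed field, then the algebraic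
closure of `k` in `Ω` embeds in `R` compatibly with a given point `R → Ω`. -/
theorem exists_algHom_section [IsAlgClosed Ω] {R K : Type*} [CommRing R] [Field K] [IsAlgClosed K]
    [Algebra R K]
    [FaithfulSMul R K] [IsIntegrallyClosedIn R K] [Algebra k R] [Algebra k K] [IsScalarTower k R K]
    (ρ : R →ₐ[k] Ω) : ∃ j : algebraicClosure k Ω →ₐ[k] R, ∀ x, ρ (j x) = x := by
  let i : algebraicClosure k Ω →ₐ[k] K := IsAlgClosed.lift
  have hi (x) : ∃ y : R, algebraMap R K y = i x :=
    IsIntegrallyClosedIn.algebraMap_eq_of_integral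
      ((Algebra.IsIntegral.isIntegral (R := k) x).map i).tower_top
  have hinj := FaithfulSMul.algebraMap_injective R K
  choose f hf using hi
  let j₀ : algebraicClosure k Ω →ₐ[k] R :=
    { toFun := f
      map_one' := hinj (by rw [hf, map_one, map_one])
      map_zero' := hinj (by rw [hf, map_zero, map_zero])
      map_mul' := fun x y => hinj (by rw [hf, map_mul, map_mul, hf, hf])
      map_add' := fun x y => hinj (by rw [hf, map_add, map_add, hf, hf])
      commutes' := fun x => hinj (by
        rw [hf, AlgHom.commutes, ← IsScalarTower.algebraMap_apply]) }
  let γ₀ : algebraicClosure k Ω →ₐ[k] algebraicClosure k Ω :=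
    { toFun := fun x => ⟨ρ (j₀ x), ((Algebra.IsIntegral.isIntegral (R := k) x).map
        (ρ.comp j₀))⟩
      map_one' := Subtype.ext (map_one (ρ.comp j₀))
      map_zero' := Subtype.ext (map_zero (ρ.comp j₀))
      map_mul' := fun x y => Subtype.ext (map_mul (ρ.comp j₀) x y)
      map_add' := fun x y => Subtype.ext (map_add (ρ.comp j₀) x y)
      commutes' := fun x => Subtype.ext ((ρ.comp j₀).commutes x) }
  let γ := AlgEquiv.ofBijective γ₀ (Algebra.IsAlgebraic.algHom_bijective γ₀)
  refine ⟨j₀.comp γ.symm.toAlgHom, fun x => ?_⟩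
  exact congrArg Subtype.val (γ.apply_symm_apply x)

end Embedding

section AbsIntegralClosure

variable {k Ω B : Type u} [Field k] [Field Ω] [IsAlgClosed Ω] [Algebra k Ω]
  [CommRing B] [IsDomain B] [Algebra k B]

/-- The integral closure of the domain `B` in an algebraic closure of its fraction field. -/
abbrev absIntegralClosure (B : Type u) [CommRing B] [IsDomain B] : Type u :=
  integralClosure B (AlgebraicClosure (FractionRing B))

theorem algebraMap_absIntegralClosure_injective :
    Function.Injective (algebraMap B (absIntegralClosure B)) := by
  refine Function.Injective.of_comp
    (f := algebraMap (absIntegralClosure B) (AlgebraicClosure (FractionRing B))) ?_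
  rw [← RingHom.coe_comp, ← IsScalarTower.algebraMap_eq,
    IsScalarTower.algebraMap_eq B (FractionRing B)]
  exact (algebraMap (FractionRing B) _).injective.comp (IsFractionRing.injective B _)

instance : FaithfulSMul B (absIntegralClosure B) :=
  (faithfulSMul_iff_algebraMap_injective _ _).mpr algebraMap_absIntegralClosure_injective

theorem uniqueLifting_absIntegralClosure {T : Type u} [CommRing T] [IsDomain T]
    (ρ : absIntegralClosure B →+* T) : UniqueLifting (Spec.map (CommRingCat.ofHom ρ)) :=
  uniqueLifting_specMap (K := AlgebraicClosure (FractionRing B)) ρ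

variable (η : Spec (.of Ω) ⟶ Spec (.of B))
  (hη : η ≫ Spec.map (CommRingCat.ofHom (algebraMap k B)) = specAlg k Ω)

include hη in
/-- A geometric point of `Spec B` extends to the absolute integral closure of `B`, and the algebraic
closure of `k` in `Ω` embeds in the latter compatibly. -/
theorem exists_extension_geomPoint :
    ∃ (ρ : absIntegralClosure B →ₐ[k] Ω) (j : algebraicClosure k Ω →ₐ[k] absIntegralClosure B),
      Spec.map (CommRingCat.ofHom ρ.toRingHom) ≫
        Spec.map (CommRingCat.ofHom (algebraMap B (absIntegralClosure B))) = η ∧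
      ∀ x, ρ (j x) = x := by
  obtain ⟨ρ, hρ⟩ := exists_ringHom_comp_algebraMap_eq (S := absIntegralClosure B)
    (Spec.preimage η).hom
  have hρη : CommRingCat.ofHom (algebraMap B (absIntegralClosure B)) ≫ CommRingCat.ofHom ρ =
      Spec.preimage η := by ext x; exact RingHom.congr_fun hρ x
  have hk : CommRingCat.ofHom (algebraMap k B) ≫ Spec.preimage η =
      CommRingCat.ofHom (algebraMap k Ω) := by
    apply Spec.map_injective
    rw [Spec.map_comp, Spec.map_preimage, hη]
  let ρ' : absIntegralClosure B →ₐ[k] Ω :=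
    { ρ with
      commutes' := fun x => by
        have h1 := ConcreteCategory.congr_hom hk x
        have h2 := RingHom.congr_fun hρ (algebraMap k B x)
        exact h2.trans h1 }
  obtain ⟨j, hj⟩ := exists_algHom_section (K := AlgebraicClosure (FractionRing B)) ρ'
  refine ⟨ρ', j, ?_, hj⟩
  refine (Spec.map_comp _ _).symm.trans ?_
  rw [← Spec.map_preimage η, ← hρη]

variable [CharZero k]

/-- A point of `Spec B` with values in a finite extension `L` of `k` splits the projection to the
Galois group over an open subgroup of index `[L : k]`. -/
theorem exists_section_of_algHom {L : Type u} [Field L] [Algebra k L] [FiniteDimensional k L]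
    (χ : B →ₐ[k] L) : ∃ H : Subgroup Gal(algebraicClosure k Ω/k),
      IsOpen (H : Set Gal(algebraicClosure k Ω/k)) ∧ H.index = Module.finrank k L ∧
      ∃ s : H →* Pi1 η, Continuous s ∧
        ∀ h, projGal (Spec.map (CommRingCat.ofHom (algebraMap k B))) η hη (s h) = h := by
  have : IsAlgClosure k (algebraicClosure k Ω) := inferInstance
  have : IsAlgClosed (algebraicClosure k Ω) := IsAlgClosure.isAlgClosed k
  have : IsGalois k (algebraicClosure k Ω) := IsAlgClosure.isGalois k _
  obtain ⟨ρ, j, hρ, hj⟩ := exists_extension_geomPoint η hη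
  let ι : L →ₐ[k] algebraicClosure k Ω := IsAlgClosed.lift
  obtain ⟨r₀, hr₀⟩ := exists_ringHom_comp_algebraMap_eq (S := absIntegralClosure B)
    (ι.comp χ).toRingHom
  let r₁ : absIntegralClosure B →ₐ[k] algebraicClosure k Ω :=
    { r₀ with
      commutes' := fun x => by
        refine (RingHom.congr_fun hr₀ (algebraMap k B x)).trans ?_
        exact (ι.comp χ).commutes x }
  let γ := AlgEquiv.ofBijective (r₁.comp j) (Algebra.IsAlgebraic.algHom_bijective _)
  -- The point is moved by a Galois conjugation so that it becomes a retraction of `j`.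
  let r : absIntegralClosure B →ₐ[k] algebraicClosure k Ω := γ.symm.toAlgHom.comp r₁
  have hrj (x) : r (j x) = x := γ.symm_apply_apply x
  let E : IntermediateField k (algebraicClosure k Ω) := (γ.symm.toAlgHom.comp ι).fieldRange
  have hrE (b : B) : r (algebraMap B _ b) ∈ E :=
    ⟨χ b, (congrArg γ.symm (RingHom.congr_fun hr₀ b)).symm⟩
  have hfin : Module.finrank k E = Module.finrank k L :=
    (AlgEquiv.ofInjectiveField (γ.symm.toAlgHom.comp ι)).toLinearEquiv.finrank_eq.symm
  have : FiniteDimensional k E :=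
    (AlgEquiv.ofInjectiveField (γ.symm.toAlgHom.comp ι)).toLinearEquiv.finiteDimensional
  refine ⟨E.fixingSubgroup, E.fixingSubgroup_isOpen,
    (IntermediateField.finrank_eq_fixingSubgroup_index _ E).symm.trans hfin, ?_⟩
  let a : E.fixingSubgroup →* (algebraicClosure k Ω →+* algebraicClosure k Ω) :=
    { toFun := fun h => (h : Gal(algebraicClosure k Ω/k)).toAlgHom.toRingHom
      map_one' := rfl
      map_mul' := fun _ _ => rfl }
  have ha (h) : Spec.map (CommRingCat.ofHom (a h)) ≫ Spec.map (CommRingCat.ofHom r.toRingHom) ≫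
      Spec.map (CommRingCat.ofHom (algebraMap B (absIntegralClosure B))) =
      Spec.map (CommRingCat.ofHom r.toRingHom) ≫
        Spec.map (CommRingCat.ofHom (algebraMap B (absIntegralClosure B))) := by
    simp only [← Spec.map_comp]
    congr 1
    ext b
    exact congrArg Subtype.val (h.2 ⟨_, hrE b⟩)
  let D := LiftingAction.ofRing (η := η)
    (Spec.map (CommRingCat.ofHom (algebraMap B (absIntegralClosure B)))) ρ.toRingHom r.toRingHom
    (uniqueLifting_absIntegralClosure _) (uniqueLifting_absIntegralClosure _) hρ a ha
  refine ⟨D.toPi1, ?_, fun h => ?_⟩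
  · refine LiftingAction.continuous_toPi1_ofRing _ _ _ _ _ _ _ _ fun t => ?_
    let F := IntermediateField.adjoin k {t}
    have : FiniteDimensional k F :=
      IntermediateField.adjoin.finiteDimensional (Algebra.IsIntegral.isIntegral t)
    have h1 : (F.fixingSubgroup : Set Gal(algebraicClosure k Ω/k)) ∈ nhds 1 :=
      F.fixingSubgroup_isOpen.mem_nhds (one_mem _)
    filter_upwards [continuous_subtype_val.continuousAt.preimage_mem_nhds h1] with h hh
    exact hh ⟨t, IntermediateField.mem_adjoin_simple_self k t⟩
  · refine (congrArg toGal (D.map_toPi1 _ hη h)).trans ?_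
    refine toGal_toPi1_ofRing _ ?_ _ _ _ _ _ _ _ j hj _ _ fun x => ?_
    · rw [← Spec.map_comp]; rfl
    · change (h : Gal(algebraicClosure k Ω/k)) (r (j x)) = r (j _)
      rw [hrj, hrj]

end AbsIntegralClosure

/-! ### Exactness of the fundamental sequence over a normal domain -/

section Pi1Elements

variable {Ω : Type u} [Field Ω] {X : Scheme.{u}} (η : Spec (.of Ω) ⟶ X)

open PreGaloisCategory in
theorem Pi1.isClosed_smul_eq {Y : FinEtCover X} (y y' : GeomFiber η Y) :
    IsClosed {σ : Pi1 η | σ • y = y'} := by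
  have h1 : Continuous fun σ : Pi1 η => autEmbedding (fiberFunctor η) σ Y :=
    (continuous_apply _).comp continuous_induced_dom
  exact (isClosed_discrete {α : Aut ((fiberFunctor η).obj Y) | α.hom y = y'}).preimage h1

/-- A continuous homomorphism from a compact group to `π₁(X, η)` is surjective if every element of
`π₁(X, η)` agrees at each point of each fibre with an element of the image. -/
theorem Pi1.surjective_of_forall_exists {Δ : Type*} [Group Δ] [TopologicalSpace Δ] [CompactSpace Δ]
    (s : Δ →* Pi1 η) (hs : Continuous s)
    (h : ∀ (σ : Pi1 η) (Y : FinEtCover X) (y : GeomFiber η Y), ∃ g, s g • y = σ • y) :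
    Function.Surjective s := by
  intro σ
  let S (i : Σ Y : FinEtCover X, GeomFiber η Y) : Set Δ := {g | s g • i.2 = σ • i.2}
  have hcl (i) : IsClosed (S i) := (Pi1.isClosed_smul_eq η i.2 (σ • i.2)).preimage hs
  have hdir : Directed (· ⊇ ·) S := by
    rintro ⟨Y, y⟩ ⟨Z, z⟩
    let W : FinEtCover X := ⟨pullback Y.hom Z.hom, pullback.fst _ _ ≫ Y.hom⟩
    let f : W ⟶ Y := ⟨pullback.fst _ _, rfl⟩
    let g : W ⟶ Z := ⟨pullback.snd _ _, pullback.condition.symm⟩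
    let t : GeomFiber η W := ⟨pullback.lift y.pt z.pt (y.w.trans z.w.symm),
      (Category.assoc _ _ _).symm.trans
        ((congrArg (· ≫ Y.hom) (pullback.lift_fst _ _ _)).trans y.w)⟩
    have hf : GeomFiber.map η f t = y := GeomFiber.ext (pullback.lift_fst _ _ _)
    have hg : GeomFiber.map η g t = z := GeomFiber.ext (pullback.lift_snd _ _ _)
    refine ⟨⟨W, t⟩, fun γ hγ => ?_, fun γ hγ => ?_⟩ <;> change s γ • t = σ • t at hγ
    · change s γ • y = σ • y
      rw [← hf, Pi1.smul_fiberMap, Pi1.smul_fiberMap, hγ]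
    · change s γ • z = σ • z
      rw [← hg, Pi1.smul_fiberMap, Pi1.smul_fiberMap, hγ]
  have : Nonempty (Σ Y : FinEtCover X, GeomFiber η Y) :=
    ⟨⟨⟨X, 𝟙 X⟩, ⟨η, Category.comp_id _⟩⟩⟩
  obtain ⟨g, hg⟩ := IsCompact.nonempty_iInter_of_directed_nonempty_isCompact_isClosed S hdir
    (fun i => h σ i.1 i.2) (fun i => (hcl i).isCompact) hcl
  exact ⟨g, Pi1.ext_smul fun Y y => Set.mem_iInter.mp hg ⟨Y, y⟩⟩

/-- Elements of `π₁(X, η)` preserve the connected components of covers: if a function `e` on the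
cover `Y` with `e ^ 2 = e` vanishes at a point of the fibre, it vanishes at its translates. -/
theorem Pi1.idempotent_smul_eq_zero (σ : Pi1 η) (Y : FinEtCover X) [IsAffine Y.left]
    (e : Γ(Y.left, ⊤)) (he : IsIdempotentElem e) (y : GeomFiber η Y)
    (hy : (Spec.preimage (y.pt ≫ Y.left.isoSpec.hom)).hom e = 0) :
    (Spec.preimage ((σ • y).pt ≫ Y.left.isoSpec.hom)).hom e = 0 := by
  let Q := Γ(Y.left, ⊤) ⧸ Ideal.span {e}
  let q : Γ(Y.left, ⊤) ⟶ .of Q := CommRingCat.ofHom (Ideal.Quotient.mk (Ideal.span {e}))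
  have : IsLocalization.Away (1 - e) Q := IsLocalization.away_of_isIdempotentElem he.one_sub
    (by rw [sub_sub_cancel]; exact Ideal.mk_ker) Ideal.Quotient.mk_surjective
  have : IsOpenImmersion (Spec.map q) := IsOpenImmersion.of_isLocalization (1 - e)
  have : IsClosedImmersion (Spec.map q) :=
    IsClosedImmersion.spec_of_surjective _ Ideal.Quotient.mk_surjective
  let Z : FinEtCover X := ⟨Spec (.of Q), Spec.map q ≫ Y.left.isoSpec.inv ≫ Y.hom⟩
  let f : Z ⟶ Y := ⟨Spec.map q ≫ Y.left.isoSpec.inv, Category.assoc _ _ _⟩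
  let ψ : CommRingCat.of Q ⟶ .of Ω := CommRingCat.ofHom (Ideal.Quotient.lift (Ideal.span {e})
    (Spec.preimage (y.pt ≫ Y.left.isoSpec.hom)).hom (by
      intro a ha
      obtain ⟨b, rfl⟩ := Ideal.mem_span_singleton'.mp ha
      rw [map_mul, hy, mul_zero]))
  have hψ : q ≫ ψ = Spec.preimage (y.pt ≫ Y.left.isoSpec.hom) := by
    ext a; rfl
  have hψ' : Spec.map ψ ≫ f.left = y.pt := by
    change Spec.map ψ ≫ Spec.map q ≫ _ = _
    rw [← Category.assoc, ← Spec.map_comp, hψ, Spec.map_preimage]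
    simp
  let z : GeomFiber η Z := ⟨Spec.map ψ, by rw [← f.w, ← Category.assoc, hψ', y.w]⟩
  have hz : GeomFiber.map η f z = y := GeomFiber.ext hψ'
  rw [← hz, Pi1.smul_fiberMap]
  have h1 : Spec.preimage ((GeomFiber.map η f (σ • z)).pt ≫ Y.left.isoSpec.hom) =
      q ≫ Spec.preimage (σ • z).pt := by
    apply Spec.map_injective
    rw [Spec.map_comp, Spec.map_preimage, Spec.map_preimage]
    change ((σ • z).pt ≫ Spec.map q ≫ Y.left.isoSpec.inv) ≫ _ = _
    simp
  rw [h1]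
  change (Spec.preimage (σ • z).pt).hom (Ideal.Quotient.mk _ e) = 0
  rw [Ideal.Quotient.eq_zero_iff_mem.mpr (Ideal.mem_span_singleton_self e), map_zero]

end Pi1Elements

section NormalAction

variable {k Ω B : Type u} [Field k] [CharZero k] [Field Ω] [Algebra k Ω]
  [CommRing B] [IsDomain B] [Algebra k B]

/-- The Galois group of the fraction field of `B` acts on the absolute integral closure of `B`. -/
noncomputable def galAbsIntegralClosure :
    Gal(AlgebraicClosure (FractionRing B)/FractionRing B) →*
      (absIntegralClosure B →+* absIntegralClosure B) where
  toFun g := (AlgEquiv.mapIntegralClosure (g.restrictScalars B)).toAlgHom.toRingHom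
  map_one' := rfl
  map_mul' _ _ := rfl

theorem galAbsIntegralClosure_algebraMap
    (g : Gal(AlgebraicClosure (FractionRing B)/FractionRing B)) (b : B) :
    galAbsIntegralClosure g (algebraMap B _ b) = algebraMap B _ b :=
  (AlgEquiv.mapIntegralClosure (g.restrictScalars B)).commutes b

theorem galAbsIntegralClosure_w (g : Gal(AlgebraicClosure (FractionRing B)/FractionRing B)) :
    Spec.map (CommRingCat.ofHom (galAbsIntegralClosure g)) ≫
      Spec.map (CommRingCat.ofHom (RingHom.id _)) ≫
      Spec.map (CommRingCat.ofHom (algebraMap B (absIntegralClosure B))) =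
      Spec.map (CommRingCat.ofHom (RingHom.id _)) ≫
      Spec.map (CommRingCat.ofHom (algebraMap B (absIntegralClosure B))) := by
  simp only [← Spec.map_comp]
  congr 1
  ext b
  exact congrArg Subtype.val (galAbsIntegralClosure_algebraMap g b)

/-- The action of the Galois group of the fraction field of `B` on the fibres of the covers of
`Spec B` over the geometric point `η`, through an extension `ρ` of `η` to the absolute integral
closure of `B`. -/
noncomputable abbrev galAction {η : Spec (.of Ω) ⟶ Spec (.of B)} (ρ : absIntegralClosure B →+* Ω)
    (hρ : Spec.map (CommRingCat.ofHom ρ) ≫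
      Spec.map (CommRingCat.ofHom (algebraMap B (absIntegralClosure B))) = η) :
    LiftingAction η Gal(AlgebraicClosure (FractionRing B)/FractionRing B) :=
  LiftingAction.ofRing _ ρ (RingHom.id _) (uniqueLifting_absIntegralClosure _)
    (uniqueLifting_absIntegralClosure _) hρ galAbsIntegralClosure galAbsIntegralClosure_w

variable {η : Spec (.of Ω) ⟶ Spec (.of B)} (ρ : absIntegralClosure B →+* Ω)
    (hρ : Spec.map (CommRingCat.ofHom ρ) ≫
      Spec.map (CommRingCat.ofHom (algebraMap B (absIntegralClosure B))) = η)

/-- If `B` is normal, then each translate `σ • y` of a point `y` of a fibre under `π₁` is also a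
translate of `y` under the Galois group: both points lie on the same connected component, on which
the Galois group acts transitively. -/
theorem exists_galAction_smul_eq [IsIntegrallyClosed B] (σ : Pi1 η) (Y : FinEtCover (Spec (.of B)))
    (y : GeomFiber η Y) : ∃ g, (galAction ρ hρ).toPi1 g • y = σ • y := by
  have : IsAffine Y.left := isAffine_of_isAffineHom Y.hom
  let e := Y.left.isoSpec
  let φ : CommRingCat.of B ⟶ Γ(Y.left, ⊤) := Spec.preimage (e.inv ≫ Y.hom)
  have hφ : Spec.map φ = e.inv ≫ Y.hom := Spec.map_preimage _
  algebraize [φ.hom]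
  have h1 : IsFinite (Spec.map φ) := by rw [hφ]; infer_instance
  have h2 : Etale (Spec.map φ) := by rw [hφ]; infer_instance
  have : Module.Finite B Γ(Y.left, ⊤) := IsFinite.SpecMap_iff φ |>.mp h1
  have : Algebra.Etale B Γ(Y.left, ⊤) := HasRingHomProperty.Spec_iff (P := @Etale) |>.mp h2
  have hext (y : GeomFiber η Y) : ∃ f : Γ(Y.left, ⊤) →ₐ[B] absIntegralClosure B,
      (Spec.map (CommRingCat.ofHom f.toRingHom) ≫ e.inv) ≫ Y.hom =
        Spec.map (CommRingCat.ofHom (algebraMap B (absIntegralClosure B))) ∧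
      Spec.map (CommRingCat.ofHom ρ) ≫ Spec.map (CommRingCat.ofHom f.toRingHom) ≫ e.inv = y.pt ∧
      ∀ c, ρ (f c) = (Spec.preimage (y.pt ≫ e.hom)).hom c := by
    obtain ⟨v, ⟨hv1, hv2⟩, -⟩ := uniqueLifting_absIntegralClosure ρ Y.hom _ y.pt
      (y.w.trans hρ.symm)
    have h3 : φ ≫ Spec.preimage (v ≫ e.hom) =
        CommRingCat.ofHom (algebraMap B (absIntegralClosure B)) := by
      apply Spec.map_injective
      rw [Spec.map_comp, Spec.map_preimage, hφ, ← hv1]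
      simp
    have h4 : Spec.preimage (v ≫ e.hom) ≫ CommRingCat.ofHom ρ =
        Spec.preimage (y.pt ≫ e.hom) := by
      apply Spec.map_injective
      rw [Spec.map_comp, Spec.map_preimage, Spec.map_preimage, reassoc_of% hv2]
    have h5 : Spec.map (Spec.preimage (v ≫ e.hom)) ≫ e.inv = v := by
      rw [Spec.map_preimage]; simp
    refine ⟨{ (Spec.preimage (v ≫ e.hom)).hom with
      commutes' := fun b => ConcreteCategory.congr_hom h3 b }, ?_, ?_, ?_⟩
    · exact (congrArg (· ≫ Y.hom) h5).trans hv1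
    · exact (congrArg (_ ≫ ·) h5).trans hv2
    · exact fun c => ConcreteCategory.congr_hom h4 c
  obtain ⟨f, hf1, hf2, hf3⟩ := hext y
  obtain ⟨f', hf'1, hf'2, hf'3⟩ := hext (σ • y)
  let val := (integralClosure B (AlgebraicClosure (FractionRing B))).val
  obtain ⟨g, hg⟩ := exists_algEquiv_comp_eq (M := FractionRing B) (val.comp f) (val.comp f') (by
    intro c hc h0
    have h0' : f c = 0 := Subtype.ext h0
    have h6 : ρ (f' c) = 0 := by
      rw [hf'3]
      refine Pi1.idempotent_smul_eq_zero η σ Y c hc y ?_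
      rw [← hf3, h0', map_zero]
    rcases IsIdempotentElem.iff_eq_zero_or_one.mp (hc.map f') with h | h
    · exact congrArg Subtype.val h
    · rw [h, map_one] at h6
      exact absurd h6 one_ne_zero)
  refine ⟨g, (LiftingAction.rel_iff _).mp ⟨_, _, hf1, hf'1, hf2, hf'2, ?_⟩⟩
  have h7 : CommRingCat.ofHom f'.toRingHom =
      CommRingCat.ofHom f.toRingHom ≫ CommRingCat.ofHom (galAbsIntegralClosure g) := by
    ext c
    exact (hg c).symm
  change Spec.map (CommRingCat.ofHom (RingHom.id _)) ≫ _ =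
    Spec.map (CommRingCat.ofHom (galAbsIntegralClosure g)) ≫
      Spec.map (CommRingCat.ofHom (RingHom.id _)) ≫ _
  rw [h7]
  have h8 : Spec.map (CommRingCat.ofHom (RingHom.id (absIntegralClosure B))) = 𝟙 _ := Spec.map_id _
  rw [h8, Spec.map_comp]
  simp only [Category.id_comp, Category.assoc]

/-- For a normal domain `B` of characteristic zero, the Galois group of the fraction field of `B`
maps onto the fundamental group of `Spec B`. -/
theorem galAction_toPi1_surjective [IsIntegrallyClosed B] [CharZero B] :
    Function.Surjective (galAction ρ hρ).toPi1 := by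
  refine Pi1.surjective_of_forall_exists η _ ?_ (exists_galAction_smul_eq ρ hρ)
  refine LiftingAction.continuous_toPi1_ofRing _ _ _ _ _ _ _ _ fun t => ?_
  let F := IntermediateField.adjoin (FractionRing B) {(t : AlgebraicClosure (FractionRing B))}
  have : FiniteDimensional (FractionRing B) F :=
    IntermediateField.adjoin.finiteDimensional (Algebra.IsIntegral.isIntegral _)
  filter_upwards [F.fixingSubgroup_isOpen.mem_nhds (one_mem _)] with g hg
  exact Subtype.ext (hg ⟨t, IntermediateField.mem_adjoin_simple_self _ _⟩)

/-- Exactness in the middle of the fundamental exact sequence for a normal domain `B` over `k`. -/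
theorem ker_projGal_le_range_geomToArith [IsAlgClosed Ω] [IsIntegrallyClosed B]
    (hη : η ≫ Spec.map (CommRingCat.ofHom (algebraMap k B)) = specAlg k Ω) :
    (projGal (Spec.map (CommRingCat.ofHom (algebraMap k B))) η hη).ker ≤
      (geomToArith (Spec.map (CommRingCat.ofHom (algebraMap k B))) η hη).range := by
  intro σ hσ
  have : CharZero B := charZero_of_injective_algebraMap (algebraMap k B).injective
  obtain ⟨ρ, j, hρ, hj⟩ := exists_extension_geomPoint η hη
  obtain ⟨g, rfl⟩ := galAction_toPi1_surjective ρ.toRingHom hρ σ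
  let f := Spec.map (CommRingCat.ofHom (algebraMap k B))
  have hz : Spec.map (CommRingCat.ofHom (algebraMap B (absIntegralClosure B))) ≫ f =
      Spec.map (CommRingCat.ofHom (algebraMap k (absIntegralClosure B))) := by
    rw [← Spec.map_comp]; rfl
  have hg (x : algebraicClosure k Ω) : galAbsIntegralClosure g (j x) = j x := by
    let D := (galAction ρ.toRingHom hρ).push f hη
    have h0 : toGal (D.toPi1 g) = 1 :=
      (congrArg toGal (LiftingAction.map_toPi1 _ f hη g)).symm.trans hσ
    exact apply_eq_of_toGal_toPi1_ofRing_eq_one _ hz ρ.toRingHom (RingHom.id _)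
      D.uniqueLifting_p D.uniqueLifting_r D.w _ D.act_w j hj g h0 x
  let z : Spec (.of (absIntegralClosure B)) ⟶ geomScheme Ω f :=
    pullback.lift (Spec.map (CommRingCat.ofHom (algebraMap B (absIntegralClosure B))))
      (Spec.map (CommRingCat.ofHom j.toRingHom)) (by
        rw [hz, ← Spec.map_comp]
        congr 1
        ext x
        exact congrArg Subtype.val (j.commutes x).symm)
  let Δ : Subgroup Gal(AlgebraicClosure (FractionRing B)/FractionRing B) :=
    fixingSubgroup _ (Set.range fun x => (j x : AlgebraicClosure (FractionRing B)))
  let D : LiftingAction (geomPoint f η hη) Δ := LiftingAction.ofRing z ρ.toRingHom (RingHom.id _)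
    (uniqueLifting_absIntegralClosure _) (uniqueLifting_absIntegralClosure _) (by
      refine pullback.hom_ext ?_ ?_ <;> rw [Category.assoc]
      · rw [pullback.lift_fst, hρ]
        exact (pullback.lift_fst _ _ _).symm
      · rw [pullback.lift_snd, ← Spec.map_comp]
        refine Eq.trans ?_ (pullback.lift_snd _ _ _).symm
        congr 1
        ext x
        exact hj x)
    (galAbsIntegralClosure.comp Δ.subtype) (by
      intro h
      refine pullback.hom_ext ?_ ?_ <;> simp only [Category.assoc]
      · rw [pullback.lift_fst]
        exact galAbsIntegralClosure_w _
      · rw [pullback.lift_snd]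
        simp only [← Spec.map_comp]
        congr 1
        ext x
        exact h.2 ⟨_, x, rfl⟩)
  have hgΔ : g ∈ Δ := by
    rw [mem_fixingSubgroup_iff]
    rintro _ ⟨x, rfl⟩
    exact congrArg Subtype.val (hg x)
  refine ⟨D.toPi1 ⟨g, hgΔ⟩, ?_⟩
  refine (D.map_toPi1 _ (geomPoint_fst f η hη) _).trans (Pi1.ext_smul fun Y y => ?_)
  rw [← LiftingAction.rel_iff]
  obtain ⟨v, v', h1, h2, h3, h4, h5⟩ := (galAction ρ.toRingHom hρ).rel_move g Y y
  have h6 : z ≫ pullback.fst _ _ =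
    Spec.map (CommRingCat.ofHom (algebraMap B (absIntegralClosure B))) := pullback.lift_fst _ _ _
  exact ⟨v, v', h1.trans h6.symm, h2.trans h6.symm, h3, h4, h5⟩

end NormalAction

/-! ### Normality and quotients by a prime element -/

section Normality

theorem exists_eq_pow_mul_and_not_dvd_of_isLocalRing {A : Type*} [CommRing A] [IsNoetherianRing A]
    [IsLocalRing A] {S : A} (hS : ¬IsUnit S) {a : A} (ha : a ≠ 0) :
    ∃ m a', ¬S ∣ a' ∧ a = S ^ m * a' := by
  have hfin : FiniteMultiplicity S a := by
    by_contra h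
    have h := FiniteMultiplicity.not_iff_forall.mp h
    refine ha ?_
    have h1 := Ideal.iInf_pow_eq_bot_of_isLocalRing (Ideal.span {S})
      (by rwa [Ne, Ideal.span_singleton_eq_top])
    rw [← Ideal.mem_bot, ← h1, Ideal.mem_iInf]
    intro i
    rw [Ideal.span_singleton_pow, Ideal.mem_span_singleton]
    exact h i
  obtain ⟨c, hc, hn⟩ := hfin.exists_eq_pow_mul_and_not_dvd
  exact ⟨_, c, hn, hc⟩

/-- A Noetherian local ring is a domain if its quotient by a regular element is a domain. -/
theorem isDomain_of_isPrime_span_singleton {A : Type*} [CommRing A] [IsNoetherianRing A]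
    [IsLocalRing A] {S : A} (hS : S ∈ nonZeroDivisors A) (hp : (Ideal.span {S}).IsPrime) :
    IsDomain A := by
  have hu : ¬IsUnit S := fun h => hp.ne_top (Ideal.span_singleton_eq_top.mpr h)
  have : NoZeroDivisors A := ⟨fun {a b} hab => by
    by_contra! h
    obtain ⟨m, a', ha', rfl⟩ := exists_eq_pow_mul_and_not_dvd_of_isLocalRing hu h.1
    obtain ⟨l, b', hb', rfl⟩ := exists_eq_pow_mul_and_not_dvd_of_isLocalRing hu h.2
    have h1 : a' * b' * S ^ (m + l) = 0 := by rw [← hab]; ring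
    have h2 := (mem_nonZeroDivisors_iff_right.mp (pow_mem hS (m + l))) _ h1
    have h3 : a' * b' ∈ Ideal.span {S} := h2 ▸ zero_mem _
    rcases hp.mem_or_mem h3 with h | h
    · exact ha' (Ideal.mem_span_singleton.mp h)
    · exact hb' (Ideal.mem_span_singleton.mp h)⟩
  exact NoZeroDivisors.to_isDomain A

/-- In a Noetherian integrally closed domain, an almost integral fraction `a / b` is an element of
the domain. -/
theorem dvd_of_forall_pow_dvd_mul_pow {D : Type*} [CommRing D] [IsDomain D] [IsNoetherianRing D]
    [IsIntegrallyClosed D] {a b d : D} (hd : d ≠ 0) (hb : b ≠ 0)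
    (h : ∀ m, b ^ m ∣ d * a ^ m) : b ∣ a := by
  let K := FractionRing D
  have hb' : algebraMap D K b ≠ 0 := by
    rwa [Ne, FaithfulSMul.algebraMap_eq_zero_iff]
  have hx : IsAlmostIntegral D (algebraMap D K a / algebraMap D K b) := by
    refine ⟨d, mem_nonZeroDivisors_of_ne_zero hd, fun m => ?_⟩
    obtain ⟨e, he⟩ := h m
    refine ⟨e, ?_⟩
    rw [Algebra.smul_def, div_pow, ← mul_div_assoc, eq_div_iff (pow_ne_zero _ hb'), ← map_pow,
      ← map_pow, ← map_mul, ← map_mul, he, mul_comm]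
  obtain ⟨y, hy⟩ := IsIntegrallyClosed.isIntegral_iff.mp hx.isIntegral
  refine ⟨y, IsFractionRing.injective D K ?_⟩
  rw [map_mul, hy, mul_div_cancel₀ _ hb']

variable {A : Type*} [CommRing A] [IsNoetherianRing A] [IsLocalRing A]

/-- Krull's intersection theorem for `A / (b)`: the ideal `(b)` is closed. -/
theorem dvd_of_forall_eq_mul_add_pow_mul {S a b : A} (hS : ¬IsUnit S)
    (h : ∀ N : ℕ, ∃ y c, a = b * y + S ^ N * c) : b ∣ a := by
  have h1 := Ideal.iInf_pow_smul_eq_bot_of_isLocalRing (M := A ⧸ Ideal.span {b})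
    (Ideal.span {S}) (by rwa [Ne, Ideal.span_singleton_eq_top])
  rw [← Ideal.mem_span_singleton, ← Ideal.Quotient.eq_zero_iff_mem, ← Submodule.mem_bot A, ← h1,
    Submodule.mem_iInf]
  intro N
  obtain ⟨y, c, hy⟩ := h N
  have h2 : Ideal.Quotient.mk (Ideal.span {b}) a =
      S ^ N • Ideal.Quotient.mk (Ideal.span {b}) c := by
    rw [hy, map_add, Ideal.Quotient.eq_zero_iff_mem.mpr
      (Ideal.mul_mem_right _ _ (Ideal.mem_span_singleton_self b)), zero_add, Algebra.smul_def,
      map_mul]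
    rfl
  rw [h2, Ideal.span_singleton_pow]
  exact Submodule.smul_mem_smul (Ideal.mem_span_singleton_self _) trivial

variable [IsDomain A]

/-- The case of `isIntegrallyClosed_of_quotient_span_singleton` in which neither the denominator `b`
nor the conductor element `d` is divisible by `S`. Normality of `A / (S)` gives `a = b y + S a₁`,
and `a₁` satisfies the same hypothesis as `a`; iterating, `a` lies in the closure of `(b)`. -/
theorem dvd_of_forall_pow_dvd_mul_pow_of_not_dvd {S : A} (hS : Prime S)
    [IsIntegrallyClosed (A ⧸ Ideal.span {S})]
    {a b d : A} (hb : ¬S ∣ b) (hd : ¬S ∣ d) (h : ∀ m, b ^ m ∣ d * a ^ m) : b ∣ a := by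
  refine dvd_of_forall_eq_mul_add_pow_mul hS.not_isUnit fun N => ?_
  have hprime : (Ideal.span {S}).IsPrime := (Ideal.span_singleton_prime hS.ne_zero).mpr hS
  have hdom : IsDomain (A ⧸ Ideal.span {S}) := Ideal.Quotient.isDomain _
  have hmk : ∀ x, Ideal.Quotient.mk (Ideal.span {S}) x = 0 ↔ S ∣ x := fun x => by
    rw [Ideal.Quotient.eq_zero_iff_mem, Ideal.mem_span_singleton]
  induction N generalizing a with
  | zero => exact ⟨0, a, by ring⟩
  | succ N ih =>
    obtain ⟨y', hy'⟩ :
        Ideal.Quotient.mk (Ideal.span {S}) b ∣ Ideal.Quotient.mk (Ideal.span {S}) a :=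
      dvd_of_forall_pow_dvd_mul_pow (d := Ideal.Quotient.mk (Ideal.span {S}) d)
        (mt (hmk d).mp hd) (mt (hmk b).mp hb) fun m => by
          simpa only [map_mul, map_pow] using map_dvd (Ideal.Quotient.mk (Ideal.span {S})) (h m)
    obtain ⟨y, rfl⟩ := Ideal.Quotient.mk_surjective y'
    obtain ⟨a₁, ha₁⟩ : S ∣ a - b * y := by
      rw [← hmk, map_sub, hy', map_mul, sub_self]
    obtain ⟨y₁, c, hc⟩ := ih (a := a₁) fun m => by
      have h1 : b ^ m ∣ S ^ m * (d * a₁ ^ m) := by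
        have : S ^ m * (d * a₁ ^ m) = d * (a + b * -y) ^ m := by
          rw [show a + b * -y = S * a₁ by rw [← ha₁]; ring]; ring
        rw [this, add_pow, Finset.mul_sum]
        refine Finset.dvd_sum fun i hi => ?_
        obtain ⟨e, he⟩ := h i
        have him : i + (m - i) = m := by
          have := Finset.mem_range.mp hi; omega
        refine ⟨e * (-y) ^ (m - i) * (m.choose i), ?_⟩
        have hbm : b ^ m = b ^ i * b ^ (m - i) := by rw [← pow_add, him]
        rw [mul_pow, ← mul_assoc, ← mul_assoc, he, hbm]
        ring
      obtain ⟨e, he⟩ := h1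
      obtain ⟨e', rfl⟩ := hS.pow_dvd_of_dvd_mul_left m (fun h => hb (hS.dvd_of_dvd_pow h))
        (Dvd.intro _ he)
      exact ⟨e', mul_left_cancel₀ (pow_ne_zero m hS.ne_zero) (by rw [he]; ring)⟩
    exact ⟨y + S * y₁, c, by rw [← sub_add_cancel a (b * y), ha₁, hc]; ring⟩

/-- A Noetherian local domain is integrally closed if its quotient by a prime element is. -/
theorem isIntegrallyClosed_of_quotient_span_singleton {S : A} (hS : Prime S)
    [IsIntegrallyClosed (A ⧸ Ideal.span {S})] :
    IsIntegrallyClosed A := by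
  -- A fraction `a / b` integral over `A` satisfies `b ^ m ∣ d * a ^ m` for some `d ≠ 0`
  -- and all `m`.
  have key : ∀ (v : ℕ) (a b d : A), d ≠ 0 → ¬S ∣ b → (∀ m, (S ^ v * b) ^ m ∣ d * a ^ m) →
      S ^ v * b ∣ a := by
    intro v
    induction v with
    | zero =>
      intro a b d hd hb h
      obtain ⟨l, d', hd', rfl⟩ := exists_eq_pow_mul_and_not_dvd_of_isLocalRing hS.not_isUnit hd
      rw [pow_zero, one_mul] at h ⊢
      refine dvd_of_forall_pow_dvd_mul_pow_of_not_dvd hS hb hd' fun m => ?_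
      obtain ⟨e, he⟩ := h m
      obtain ⟨e', rfl⟩ := hS.pow_dvd_of_dvd_mul_left l (fun h => hb (hS.dvd_of_dvd_pow h))
        (Dvd.intro _ ((mul_assoc _ _ _).symm.trans he))
      exact ⟨e', mul_left_cancel₀ (pow_ne_zero l hS.ne_zero) (by rw [← mul_assoc, he]; ring)⟩
    | succ v ih =>
      intro a b d hd hb h
      have hSa : S ∣ a := by
        by_contra hSa
        obtain ⟨l, d', hd', rfl⟩ := exists_eq_pow_mul_and_not_dvd_of_isLocalRing hS.not_isUnit hd
        have h1 : S ^ (l + 1) ∣ S ^ l * d' := by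
          refine hS.pow_dvd_of_dvd_mul_right _ (fun h => hSa (hS.dvd_of_dvd_pow h))
            (Dvd.dvd.trans ?_ (h (l + 1)))
          exact pow_dvd_pow_of_dvd (Dvd.intro (S ^ v * b) (by ring)) _
        rw [pow_succ] at h1
        exact hd' ((mul_dvd_mul_iff_left (pow_ne_zero l hS.ne_zero)).mp h1)
      obtain ⟨a₁, rfl⟩ := hSa
      have := ih a₁ b d hd hb fun m => by
        have := h m
        rw [show (S ^ (v + 1) * b) ^ m = S ^ m * (S ^ v * b) ^ m by ring,
          show d * (S * a₁) ^ m = S ^ m * (d * a₁ ^ m) by ring] at this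
        exact (mul_dvd_mul_iff_left (pow_ne_zero m hS.ne_zero)).mp this
      rw [show S ^ (v + 1) * b = S * (S ^ v * b) by ring]
      exact mul_dvd_mul_left _ this
  rw [isIntegrallyClosed_iff (FractionRing A)]
  intro x hx
  obtain ⟨d, hd, h⟩ := hx.isAlmostIntegral
  obtain ⟨a, b, hb, rfl⟩ := IsFractionRing.div_surjective (A := A) x
  have hb0 : b ≠ 0 := nonZeroDivisors.ne_zero hb
  have hb' : algebraMap A (FractionRing A) b ≠ 0 := by
    rwa [Ne, FaithfulSMul.algebraMap_eq_zero_iff]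
  have hdvd : ∀ m, b ^ m ∣ d * a ^ m := fun m => by
    obtain ⟨e, he⟩ := h m
    refine ⟨e, IsFractionRing.injective A (FractionRing A) ?_⟩
    rw [Algebra.smul_def, div_pow, ← mul_div_assoc, eq_div_iff (pow_ne_zero _ hb')] at he
    simp only [map_mul, map_pow] at he ⊢
    rw [← he, mul_comm]
  obtain ⟨v, b, hSb, rfl⟩ := exists_eq_pow_mul_and_not_dvd_of_isLocalRing hS.not_isUnit hb0
  obtain ⟨y, hy⟩ := key v a b d (nonZeroDivisors.ne_zero hd) hSb hdvd
  exact ⟨y, by rw [eq_div_iff hb', ← map_mul, hy, mul_comm]⟩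

end Normality

/-! ### Normality of the annulus -/

section AnnulusNormal

variable (O : Type u) [CommRing O]

/-- The substitution `S = 0`, as a homomorphism `O⟦S, T⟧ → O⟦T⟧`. -/
noncomputable def evalFstZero : MvPowerSeries (Fin 2) O →ₐ[O] PowerSeries O :=
  MvPowerSeries.killCompl ⟨fun _ : Unit => (1 : Fin 2), fun _ _ _ => rfl⟩

theorem evalFstZero_surjective : Function.Surjective (evalFstZero O) := fun f =>
  ⟨_, MvPowerSeries.killCompl_rename_app f⟩

theorem evalFstZero_X_zero : evalFstZero O (MvPowerSeries.X 0) = 0 :=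
  MvPowerSeries.killCompl_X_eq_zero (by rintro ⟨_, h⟩; exact one_ne_zero (α := Fin 2) h)

theorem evalFstZero_C (r : O) : evalFstZero O (MvPowerSeries.C r) = PowerSeries.C r :=
  MvPowerSeries.killCompl_C r

theorem ker_evalFstZero : RingHom.ker (evalFstZero O) = Ideal.span {MvPowerSeries.X 0} := by
  refine le_antisymm (fun f hf => ?_) ?_
  · rw [Ideal.mem_span_singleton, MvPowerSeries.X_dvd_iff]
    intro m hm
    have h1 : m = Finsupp.embDomain ⟨fun _ : Unit => (1 : Fin 2), fun _ _ _ => rfl⟩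
        (Finsupp.single () (m 1)) := by
      rw [Finsupp.embDomain_single]
      ext i
      fin_cases i
      · exact hm.trans (Finsupp.single_eq_of_ne (zero_ne_one (α := Fin 2))).symm
      · exact Finsupp.single_eq_same.symm
    rw [h1, ← MvPowerSeries.coeff_killCompl]
    exact (congrArg _ (show evalFstZero O f = 0 from hf)).trans (map_zero _)
  · rw [Ideal.span_singleton_le_iff_mem]
    exact evalFstZero_X_zero O

theorem prime_X_zero [IsDomain O] : Prime (MvPowerSeries.X 0 : MvPowerSeries (Fin 2) O) := by
  rw [← Ideal.span_singleton_prime, ← ker_evalFstZero]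
  · exact RingHom.ker_isPrime _
  · exact nonZeroDivisors.ne_zero MvPowerSeries.X_mem_nonzeroDivisors

variable {O} in
theorem ker_powerSeries_map_mk (π : O) :
    RingHom.ker (PowerSeries.map (Ideal.Quotient.mk (Ideal.span {π}))) =
      Ideal.span {PowerSeries.C π} := by
  refine le_antisymm (fun f hf => ?_) ?_
  · rw [Ideal.mem_span_singleton]
    have h : ∀ i, π ∣ PowerSeries.coeff i f := fun i => by
      rw [← Ideal.mem_span_singleton, ← Ideal.Quotient.eq_zero_iff_mem, ← PowerSeries.coeff_map,
        show PowerSeries.map _ f = 0 from hf, map_zero]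
    choose g hg using h
    refine ⟨PowerSeries.mk g, ?_⟩
    ext i
    rw [PowerSeries.coeff_C_mul, PowerSeries.coeff_mk, hg]
  · rw [Ideal.span_singleton_le_iff_mem, RingHom.mem_ker, PowerSeries.map_C,
      Ideal.Quotient.eq_zero_iff_mem.mpr (Ideal.mem_span_singleton_self π), map_zero]

variable {O} {π : O} {n : ℕ}

theorem evalFstZero_relation (hn : 1 ≤ n) :
    evalFstZero O (MvPowerSeries.X 0 ^ n * MvPowerSeries.X 1 - MvPowerSeries.C (σ := Fin 2) π) =
      -PowerSeries.C π := by
  rw [map_sub, map_mul, map_pow, evalFstZero_X_zero, zero_pow (by omega), zero_mul, evalFstZero_C,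
    zero_sub]

/-- The reduction of `A_n` modulo `S` is the ring `(O / π)⟦T⟧`. -/
theorem exists_annulusRing_reduction (hn : 1 ≤ n) :
    ∃ θ : AnnulusRing O π n →+* PowerSeries (O ⧸ Ideal.span {π}), Function.Surjective θ ∧
      RingHom.ker θ = Ideal.span {Ideal.Quotient.mk _ (MvPowerSeries.X 0)} := by
  let θ₀ : MvPowerSeries (Fin 2) O →+* PowerSeries (O ⧸ Ideal.span {π}) :=
    (PowerSeries.map (Ideal.Quotient.mk (Ideal.span {π}))).comp (evalFstZero O).toRingHom
  have hC : PowerSeries.map (Ideal.Quotient.mk (Ideal.span {π})) (PowerSeries.C π) = 0 := by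
    rw [← RingHom.mem_ker, ker_powerSeries_map_mk]
    exact Ideal.mem_span_singleton_self _
  have h0 : Ideal.span {MvPowerSeries.X 0 ^ n * MvPowerSeries.X 1 -
      MvPowerSeries.C (σ := Fin 2) π} ≤ RingHom.ker θ₀ := by
    rw [Ideal.span_singleton_le_iff_mem, RingHom.mem_ker]
    refine (congrArg (PowerSeries.map (Ideal.Quotient.mk (Ideal.span {π})))
      (evalFstZero_relation hn)).trans ?_
    rw [map_neg, hC, neg_zero]
  have hsurj : Function.Surjective θ₀ :=
    (PowerSeries.map_surjective _ Ideal.Quotient.mk_surjective).comp (evalFstZero_surjective O)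
  refine ⟨Ideal.Quotient.lift _ θ₀ h0, Ideal.Quotient.lift_surjective_of_surjective _ _ hsurj,
    le_antisymm (fun a ha => ?_) ?_⟩
  · obtain ⟨f, rfl⟩ := Ideal.Quotient.mk_surjective a
    have hf : evalFstZero O f ∈ Ideal.span {PowerSeries.C π} := by
      rw [← ker_powerSeries_map_mk]
      exact ha
    obtain ⟨g, hg⟩ := Ideal.mem_span_singleton.mp hf
    obtain ⟨g, rfl⟩ := evalFstZero_surjective O g
    have h1 : f - MvPowerSeries.C π * g ∈ Ideal.span {MvPowerSeries.X 0} := by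
      rw [← ker_evalFstZero, RingHom.mem_ker, map_sub, map_mul, hg, evalFstZero_C, sub_self]
    obtain ⟨e, he⟩ := Ideal.mem_span_singleton.mp h1
    have h2 : f - MvPowerSeries.X 0 * (e + MvPowerSeries.X 0 ^ (n - 1) * MvPowerSeries.X 1 * g) =
        (MvPowerSeries.X 0 ^ n * MvPowerSeries.X 1 - MvPowerSeries.C π) * -g := by
      obtain ⟨n, rfl⟩ : ∃ l, n = l + 1 := ⟨n - 1, by omega⟩
      rw [Nat.add_sub_cancel, mul_add, ← he]
      ring
    refine Ideal.mem_span_singleton.mpr ⟨Ideal.Quotient.mk _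
      (e + MvPowerSeries.X 0 ^ (n - 1) * MvPowerSeries.X 1 * g), ?_⟩
    rw [← map_mul, Ideal.Quotient.mk_eq_mk_iff_sub_mem, h2]
    exact Ideal.mul_mem_right _ _ (Ideal.mem_span_singleton_self _)
  · rw [Ideal.span_singleton_le_iff_mem, RingHom.mem_ker]
    exact (congrArg (PowerSeries.map (Ideal.Quotient.mk (Ideal.span {π})))
      (evalFstZero_X_zero O)).trans (map_zero _)

theorem X_zero_mem_nonZeroDivisors_annulusRing [IsDomain O] (hπ : π ≠ 0) (hn : 1 ≤ n) :
    (Ideal.Quotient.mk _ (MvPowerSeries.X 0) : AnnulusRing O π n) ∈ nonZeroDivisors _ := by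
  rw [mem_nonZeroDivisors_iff_right]
  intro a ha
  obtain ⟨f, rfl⟩ := Ideal.Quotient.mk_surjective a
  rw [← map_mul, Ideal.Quotient.eq_zero_iff_mem, Ideal.mem_span_singleton] at ha
  obtain ⟨g, hg⟩ := ha
  have h1 : (MvPowerSeries.X 0 : MvPowerSeries (Fin 2) O) ∣ g := by
    refine ((prime_X_zero O).dvd_or_dvd (Dvd.intro_left f hg)).resolve_left fun h => ?_
    rw [← Ideal.mem_span_singleton, ← ker_evalFstZero, RingHom.mem_ker, evalFstZero_relation hn,
      neg_eq_zero] at h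
    exact hπ (PowerSeries.C_injective (h.trans (map_zero _).symm))
  obtain ⟨e, rfl⟩ := h1
  rw [Ideal.Quotient.eq_zero_iff_mem, Ideal.mem_span_singleton]
  exact ⟨e, mul_right_cancel₀ (prime_X_zero O).ne_zero (by rw [hg]; ring)⟩

/-- The ring `A_n` is a normal domain, since `S` is a regular element of it and `A_n / (S)` is the
discrete valuation ring `(O / π)⟦T⟧`. -/
theorem annulusRing_normal [IsDomain O] [IsNoetherianRing O] [IsLocalRing O] (hπ : π ≠ 0)
    [hmax : (Ideal.span {π}).IsMaximal] (hn : 1 ≤ n) :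
    IsDomain (AnnulusRing O π n) ∧ IsIntegrallyClosed (AnnulusRing O π n) := by
  obtain ⟨θ, hθ, hker⟩ := exists_annulusRing_reduction (O := O) (π := π) hn
  let _ : Field (O ⧸ Ideal.span {π}) := Ideal.Quotient.field _
  have : Nontrivial (AnnulusRing O π n) := θ.domain_nontrivial
  have : IsLocalRing (AnnulusRing O π n) :=
    IsLocalRing.of_surjective' (Ideal.Quotient.mk _) Ideal.Quotient.mk_surjective
  have hprime := hker ▸ RingHom.ker_isPrime θ
  have hreg := X_zero_mem_nonZeroDivisors_annulusRing (n := n) hπ hn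
  have hdom := isDomain_of_isPrime_span_singleton hreg hprime
  refine ⟨hdom, ?_⟩
  have : IsIntegrallyClosed (AnnulusRing O π n ⧸
      Ideal.span {(Ideal.Quotient.mk _ (MvPowerSeries.X 0) : AnnulusRing O π n)}) :=
    IsIntegrallyClosed.of_equiv ((Ideal.quotEquivOfEq hker.symm).trans
      (RingHom.quotientKerEquivOfSurjective hθ)).symm
  exact isIntegrallyClosed_of_quotient_span_singleton
    ((Ideal.span_singleton_prime (nonZeroDivisors.ne_zero hreg)).mp hprime)

open scoped TensorProduct in
/-- The generic fibre of a normal domain is a normal domain, if it is not empty. -/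
theorem tensor_normal (A k : Type u) [CommRing A] [Algebra O A] [IsDomain O] [Field k] [Algebra O k]
    [IsFractionRing O k] [IsDomain A] [IsIntegrallyClosed A] [Nontrivial (k ⊗[O] A)] :
    IsDomain (k ⊗[O] A) ∧ IsIntegrallyClosed (k ⊗[O] A) := by
  let _ : Algebra A (k ⊗[O] A) := Algebra.TensorProduct.rightAlgebra
  have hloc : IsLocalization (Algebra.algebraMapSubmonoid A (nonZeroDivisors O)) (k ⊗[O] A) :=
    IsLocalization.tensorRight _ _
  have hle : Algebra.algebraMapSubmonoid A (nonZeroDivisors O) ≤ nonZeroDivisors A := by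
    refine le_nonZeroDivisors_of_noZeroDivisors fun h0 => ?_
    have hx := IsLocalization.map_units (k ⊗[O] A)
      (⟨0, h0⟩ : Algebra.algebraMapSubmonoid A (nonZeroDivisors O))
    rw [map_zero] at hx
    exact not_isUnit_zero hx
  exact ⟨IsLocalization.isDomain_of_le_nonZeroDivisors _ hle,
    isIntegrallyClosed_of_isLocalization _ _ hle⟩

end AnnulusNormal

/-! ### Rings of integers of finite extensions of the p-adic numbers -/

section UnitBall

variable {O K : Type*} [CommRing O] [NormedField K] [Algebra O K]

theorem isUnit_iff_norm_eq_one_of_range (hinj : Function.Injective (algebraMap O K))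
    (hO : ∀ x : K, x ∈ (algebraMap O K).range ↔ ‖x‖ ≤ 1) (a : O) :
    IsUnit a ↔ ‖algebraMap O K a‖ = 1 := by
  constructor
  · intro ha
    obtain ⟨b, hb⟩ := ha.exists_right_inv
    have h1 : ‖algebraMap O K a‖ * ‖algebraMap O K b‖ = 1 := by
      rw [← norm_mul, ← map_mul, hb, map_one, norm_one]
    have ha := (hO _).mp ⟨a, rfl⟩
    have hb := (hO _).mp ⟨b, rfl⟩
    nlinarith [norm_nonneg (algebraMap O K a)]
  · intro ha
    obtain ⟨b, hb⟩ := (hO (algebraMap O K a)⁻¹).mpr (by rw [norm_inv, ha, inv_one])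
    refine IsUnit.of_mul_eq_one b (hinj ?_)
    rw [map_mul, hb, map_one, mul_inv_cancel₀]
    rw [← norm_ne_zero_iff, ha]
    exact one_ne_zero

theorem isLocalRing_of_range_eq_unitBall [IsUltrametricDist K]
    (hinj : Function.Injective (algebraMap O K))
    (hO : ∀ x : K, x ∈ (algebraMap O K).range ↔ ‖x‖ ≤ 1) : IsLocalRing O := by
  have : Nontrivial O := (algebraMap O K).domain_nontrivial
  refine IsLocalRing.of_isUnit_or_isUnit_one_sub_self fun a => ?_
  rw [isUnit_iff_norm_eq_one_of_range hinj hO, isUnit_iff_norm_eq_one_of_range hinj hO]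
  refine or_iff_not_imp_left.mpr fun h => ?_
  have h1 : ‖algebraMap O K a‖ < ‖(1 : K)‖ := by
    rw [norm_one]
    exact lt_of_le_of_ne ((hO _).mp ⟨a, rfl⟩) h
  rw [← norm_neg] at h1
  rw [map_sub, map_one, sub_eq_add_neg, IsUltrametricDist.norm_add_eq_max_of_norm_ne_norm h1.ne',
    max_eq_left h1.le, norm_one]

theorem dvd_iff_norm_le_of_range (hinj : Function.Injective (algebraMap O K))
    (hO : ∀ x : K, x ∈ (algebraMap O K).range ↔ ‖x‖ ≤ 1) {a b : O} (ha : a ≠ 0) :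
    a ∣ b ↔ ‖algebraMap O K b‖ ≤ ‖algebraMap O K a‖ := by
  have ha' : algebraMap O K a ≠ 0 := by rwa [Ne, map_eq_zero_iff _ hinj]
  constructor
  · rintro ⟨c, rfl⟩
    rw [map_mul, norm_mul]
    exact mul_le_of_le_one_right (norm_nonneg _) ((hO _).mp ⟨c, rfl⟩)
  · intro h
    obtain ⟨c, hc⟩ := (hO (algebraMap O K b / algebraMap O K a)).mpr (by
      rw [norm_div]
      exact div_le_one_of_le₀ h (norm_nonneg _))
    exact ⟨c, hinj (by rw [map_mul, hc, mul_div_cancel₀ _ ha'])⟩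

/-- If `O` is the unit ball of a complete normed field, then it is complete for the topology defined
by the powers of an element of norm less than `1`. -/
theorem isAdicComplete_of_range_eq_unitBall [IsDomain O] [CompleteSpace K]
    (hinj : Function.Injective (algebraMap O K))
    (hO : ∀ x : K, x ∈ (algebraMap O K).range ↔ ‖x‖ ≤ 1) {π : O} (h0 : π ≠ 0)
    (h1 : ‖algebraMap O K π‖ < 1) : IsAdicComplete (Ideal.span {π}) O := by
  have hmod : ∀ n (x y : O), x ≡ y [SMOD (Ideal.span {π} ^ n • ⊤ : Submodule O O)] ↔
      ‖algebraMap O K x - algebraMap O K y‖ ≤ ‖algebraMap O K π‖ ^ n := fun n x y => by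
    rw [SModEq.sub_mem, smul_eq_mul, Ideal.mul_top, Ideal.span_singleton_pow,
      Ideal.mem_span_singleton, dvd_iff_norm_le_of_range hinj hO (pow_ne_zero n h0), map_sub,
      map_pow, norm_pow]
  have hlim := tendsto_pow_atTop_nhds_zero_of_lt_one (norm_nonneg (algebraMap O K π)) h1
  refine { haus' := fun x hx => ?_, prec' := fun f hf => ?_ }
  · refine hinj (norm_le_zero_iff.mp ?_ |>.trans (map_zero _).symm)
    refine ge_of_tendsto' hlim fun n => ?_
    simpa using (hmod n x 0).mp (hx n)
  · have hcau : CauchySeq fun n => algebraMap O K (f n) := by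
      refine cauchySeq_of_le_geometric _ 1 h1 fun n => ?_
      rw [one_mul, dist_eq_norm]
      exact (hmod _ _ _).mp (hf n.le_succ)
    obtain ⟨x, hx⟩ := cauchySeq_tendsto_of_complete hcau
    obtain ⟨L, rfl⟩ := (hO x).mpr (le_of_tendsto' hx.norm fun n => (hO _).mp ⟨_, rfl⟩)
    refine ⟨L, fun n => (hmod _ _ _).mpr ?_⟩
    refine le_of_tendsto (tendsto_const_nhds.sub hx).norm ?_
    filter_upwards [Filter.eventually_ge_atTop n] with m hm
    exact (hmod _ _ _).mp (hf hm)

end UnitBall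

section PadicIntegers

variable (p : ℕ) [Fact p.Prime] (k : Type u) [Field k]
    [Algebra ℚ_[p] k] [FiniteDimensional ℚ_[p] k] [Algebra ℤ_[p] k] [IsScalarTower ℤ_[p] ℚ_[p] k]

variable {k} in
theorem isIntegral_iff_spectralNorm_le_one (x : k) :
    IsIntegral ℤ_[p] x ↔ spectralNorm ℚ_[p] k x ≤ 1 := by
  have hx : IsIntegral ℚ_[p] x := Algebra.IsIntegral.isIntegral x
  rw [spectralNorm, spectralValue_le_one_iff (minpoly.monic hx)]
  constructor
  · intro h n
    rw [minpoly.isIntegrallyClosed_eq_field_fractions' ℚ_[p] h, Polynomial.coeff_map]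
    exact PadicInt.norm_le_one _
  · intro h
    have hl : minpoly ℚ_[p] x ∈ Polynomial.lifts (algebraMap ℤ_[p] ℚ_[p]) :=
      (Polynomial.lifts_iff_coeff_lifts _).mpr fun n => ⟨⟨_, h n⟩, rfl⟩
    obtain ⟨q, hq, -, hqm⟩ := Polynomial.lifts_and_natDegree_eq_and_monic hl (minpoly.monic hx)
    refine ⟨q, hqm, ?_⟩
    rw [← Polynomial.aeval_def, ← Polynomial.aeval_map_algebraMap ℚ_[p], hq, minpoly.aeval]

theorem isDedekindDomain_padicIntegers [CharZero k] :
    IsDedekindDomain (integralClosure ℤ_[p] k) :=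
  integralClosure.isDedekindDomain ℤ_[p] ℚ_[p] k

theorem isFractionRing_padicIntegers :
    IsFractionRing (integralClosure ℤ_[p] k) k :=
  IsIntegralClosure.isFractionRing_of_finite_extension ℤ_[p] ℚ_[p] k _

theorem mem_range_iff_spectralNorm_le_one (x : k) :
    x ∈ (algebraMap (integralClosure ℤ_[p] k) k).range ↔ spectralNorm ℚ_[p] k x ≤ 1 := by
  rw [← isIntegral_iff_spectralNorm_le_one]
  exact ⟨fun ⟨y, hy⟩ => hy ▸ y.2, fun h => ⟨⟨x, h⟩, rfl⟩⟩

theorem isLocalRing_padicIntegers : IsLocalRing (integralClosure ℤ_[p] k) := by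
  let := spectralNorm.normedField ℚ_[p] k
  have : IsUltrametricDist k := IsUltrametricDist.isUltrametricDist_of_isNonarchimedean_norm
    (isNonarchimedean_spectralNorm (K := ℚ_[p]) (L := k))
  exact isLocalRing_of_range_eq_unitBall (K := k) Subtype.val_injective
    (mem_range_iff_spectralNorm_le_one p k)

theorem isPrincipalIdealRing_padicIntegers [CharZero k] :
    IsPrincipalIdealRing (integralClosure ℤ_[p] k) := by
  have := isLocalRing_padicIntegers p k
  have := isDedekindDomain_padicIntegers p k
  exact ((tfae_of_isNoetherianRing_of_isLocalRing_of_isDomain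
    (integralClosure ℤ_[p] k)).out 0 2).mpr this

theorem isAdicComplete_padicIntegers {π : integralClosure ℤ_[p] k} (h0 : π ≠ 0)
    (h1 : ¬IsUnit π) : IsAdicComplete (Ideal.span {π}) (integralClosure ℤ_[p] k) := by
  let := spectralNorm.normedField ℚ_[p] k
  have := spectralNorm.completeSpace ℚ_[p] k
  have hO := mem_range_iff_spectralNorm_le_one p k
  exact isAdicComplete_of_range_eq_unitBall (K := k) Subtype.val_injective hO h0
    (lt_of_le_of_ne ((hO _).mp ⟨π, rfl⟩)
      (mt (isUnit_iff_norm_eq_one_of_range (K := k) Subtype.val_injective hO π).mpr h1))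

end PadicIntegers

/-! ### Points of the annulus over totally ramified extensions -/

section AnnulusPoints

open Polynomial in
theorem isWeaklyEisensteinAt_X_pow_sub_C {R : Type*} [CommRing R] [Nontrivial R] (r : R) (d : ℕ) :
    (X ^ d - C r).IsWeaklyEisensteinAt (Ideal.span {r}) := by
  refine ⟨fun {i} hi => ?_⟩
  rw [natDegree_X_pow_sub_C] at hi
  rw [coeff_sub, coeff_X_pow, if_neg hi.ne, zero_sub, coeff_C]
  split_ifs
  · exact neg_mem (Ideal.mem_span_singleton_self r)
  · simp

open Polynomial in
theorem irreducible_X_pow_sub_C_of_prime {R K : Type*} [CommRing R] [IsDomain R]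
    [IsIntegrallyClosed R] [Field K] [Algebra R K] [IsFractionRing R K] {r : R} (hr : Prime r)
    {d : ℕ} (hd : d ≠ 0) : Irreducible (X ^ d - C (algebraMap R K r) : K[X]) := by
  have hmonic : (X ^ d - C r).Monic := monic_X_pow_sub_C r hd
  have hprime := (Ideal.span_singleton_prime hr.ne_zero).mpr hr
  have h1 : Irreducible (X ^ d - C r) := by
    refine IsEisensteinAt.irreducible (𝓟 := Ideal.span {r})
      ⟨?_, (isWeaklyEisensteinAt_X_pow_sub_C r d).mem, ?_⟩ hprime hmonic.isPrimitive ?_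
    · rw [hmonic.leadingCoeff, ← Ideal.ne_top_iff_one]
      exact hprime.ne_top
    · rw [coeff_sub, coeff_X_pow, if_neg hd.symm, zero_sub, coeff_C_zero, neg_mem_iff,
        Ideal.span_singleton_pow, Ideal.mem_span_singleton]
      rintro ⟨c, hc⟩
      refine hr.not_isUnit (IsUnit.of_mul_eq_one c (mul_left_cancel₀ hr.ne_zero ?_))
      rw [mul_one, ← mul_assoc, ← pow_two, ← hc]
    · rw [natDegree_X_pow_sub_C]
      exact Nat.pos_of_ne_zero hd
  rw [hmonic.irreducible_iff_irreducible_map_fraction_map (K := K)] at h1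
  simpa using h1

variable {O : Type u} [CommRing O] [IsDomain O] {π : O}

/-- The curve `Sⁿ T = π` has the point `S = x`, `T = x ^ e` over an algebra that contains an
`(n + e)`-th root `x` of `π`. It is defined on power series because, by Weierstrass preparation, the
quotients of `O[X]` and of `O⟦X⟧` by the distinguished polynomial `X ^ (n + e) - π` agree. -/
theorem exists_algHom_annulusRing [IsAdicComplete (Ideal.span {π}) O] (n : ℕ) {e : ℕ} (he : e ≠ 0)
    {L : Type*} [CommRing L] [Algebra O L] (x : L) (hx : x ^ (n + e) = algebraMap O L π) :
    Nonempty (AnnulusRing O π n →ₐ[O] L) := by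
  have hg : (Polynomial.X ^ (n + e) - Polynomial.C π).IsDistinguishedAt (Ideal.span {π}) :=
    ⟨isWeaklyEisensteinAt_X_pow_sub_C π _, Polynomial.monic_X_pow_sub_C π (by omega)⟩
  let a : Fin 2 → MvPowerSeries Unit O := ![PowerSeries.X, PowerSeries.X ^ e]
  have ha : MvPowerSeries.HasSubst a := by
    refine MvPowerSeries.hasSubst_of_constantCoeff_zero fun i => ?_
    fin_cases i
    · exact MvPowerSeries.constantCoeff_X _
    · refine (map_pow MvPowerSeries.constantCoeff _ _).trans ?_
      rw [show MvPowerSeries.constantCoeff (PowerSeries.X : PowerSeries O) = 0 from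
        MvPowerSeries.constantCoeff_X _, zero_pow he]
  let σ : MvPowerSeries (Fin 2) O →ₐ[O] PowerSeries O := MvPowerSeries.substAlgHom ha
  let ψ : (Polynomial O ⧸ Ideal.span {Polynomial.X ^ (n + e) - Polynomial.C π}) →ₐ[O] L :=
    Ideal.Quotient.liftₐ _ (Polynomial.aeval x) fun f hf => by
      obtain ⟨c, rfl⟩ := Ideal.mem_span_singleton.mp hf
      rw [map_mul, map_sub, map_pow, Polynomial.aeval_X, Polynomial.aeval_C, hx, sub_self, zero_mul]
  let τ : MvPowerSeries (Fin 2) O →ₐ[O] L :=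
    (ψ.comp hg.algEquivQuotient.symm.toAlgHom).comp ((Ideal.Quotient.mkₐ O _).comp σ)
  have hσ : σ (MvPowerSeries.X 0 ^ n * MvPowerSeries.X 1 - MvPowerSeries.C (σ := Fin 2) π) =
      ((Polynomial.X ^ (n + e) - Polynomial.C π : Polynomial O) : PowerSeries O) := by
    have h0 : σ (MvPowerSeries.X 0) = PowerSeries.X := MvPowerSeries.substAlgHom_X ha 0
    have h1 : σ (MvPowerSeries.X 1) = PowerSeries.X ^ e := MvPowerSeries.substAlgHom_X ha 1
    have hC : σ (MvPowerSeries.C (σ := Fin 2) π) = PowerSeries.C π := σ.commutes π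
    rw [map_sub, map_mul, map_pow, h0, h1, hC, ← pow_add]
    simp
  refine ⟨Ideal.Quotient.liftₐ _ τ fun f hf => ?_⟩
  obtain ⟨c, rfl⟩ := Ideal.mem_span_singleton.mp hf
  rw [map_mul]
  refine mul_eq_zero_of_left ?_ _
  change ψ (hg.algEquivQuotient.symm (Ideal.Quotient.mk _ (σ _))) = 0
  rw [hσ, Ideal.Quotient.eq_zero_iff_mem.mpr (Ideal.mem_span_singleton_self _), map_zero, map_zero]

open scoped TensorProduct in
/-- For every `d > n`, the scheme `C_n` has a point with residue field of degree `d` over `k`. -/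
theorem exists_algHom_tensor_annulusRing [IsIntegrallyClosed O]
    [IsAdicComplete (Ideal.span {π}) O] (hπ : Prime π) (k : Type u) [Field k] [Algebra O k]
    [IsFractionRing O k] {n d : ℕ} (hd : n < d) :
    ∃ (L : Type u) (_ : Field L) (_ : Algebra k L), FiniteDimensional k L ∧
      Module.finrank k L = d ∧ Nonempty (k ⊗[O] AnnulusRing O π n →ₐ[k] L) := by
  obtain ⟨e, rfl⟩ := Nat.exists_eq_add_of_lt hd
  have hirr := irreducible_X_pow_sub_C_of_prime (K := k) hπ (d := n + (e + 1)) (by omega)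
  have := Fact.mk hirr
  let g : Polynomial k := Polynomial.X ^ (n + (e + 1)) - Polynomial.C (algebraMap O k π)
  have hx : AdjoinRoot.root g ^ (n + (e + 1)) = algebraMap O (AdjoinRoot g) π := by
    have := AdjoinRoot.eval₂_root g
    rw [Polynomial.eval₂_sub, Polynomial.eval₂_pow, Polynomial.eval₂_X, Polynomial.eval₂_C,
      sub_eq_zero] at this
    exact this
  obtain ⟨χ⟩ := exists_algHom_annulusRing n e.succ_ne_zero (AdjoinRoot.root g) hx
  refine ⟨AdjoinRoot g, inferInstance, inferInstance,
    (AdjoinRoot.powerBasis hirr.ne_zero).finite, ?_,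
    ⟨Algebra.TensorProduct.lift (Algebra.ofId k _) χ fun _ _ => Commute.all _ _⟩⟩
  exact finrank_quotient_span_eq_natDegree.trans Polynomial.natDegree_X_pow_sub_C

end AnnulusPoints

/-! ### The geometrically abelian quotient -/

section GeomAb

variable {k Ω : Type u} [Field k] [CharZero k] [Field Ω] [Algebra k Ω] {X : Scheme.{u}}
  (f : X ⟶ Spec (.of k)) (η : Spec (.of Ω) ⟶ X) (hη : η ≫ f = specAlg k Ω)

open scoped commutatorElement in
/-- If `π₁(X_k̄) → π₁(X) → G_k` is exact in the middle, then `π₁(X)^(ab)` is an extension of its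
image in `G_k` by an abelian group. -/
theorem isMulCommutative_ker_projGalAb
    (hex : (projGal f η hη).ker ≤ (geomToArith f η hη).range) :
    IsMulCommutative (projGalAb f η hη).ker := by
  refine ⟨⟨?_⟩⟩
  rintro ⟨x, hx⟩ ⟨y, hy⟩
  obtain ⟨σ, rfl⟩ := QuotientGroup.mk_surjective x
  obtain ⟨τ, rfl⟩ := QuotientGroup.mk_surjective y
  obtain ⟨α, rfl⟩ := hex (show σ ∈ (projGal f η hη).ker from hx)
  obtain ⟨β, rfl⟩ := hex (show τ ∈ (projGal f η hη).ker from hy)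
  refine Subtype.ext ?_
  change ((geomToArith f η hη α * geomToArith f η hη β : Pi1 η) : Pi1GeomAb f η hη) =
    ((geomToArith f η hη β * geomToArith f η hη α : Pi1 η) : Pi1GeomAb f η hη)
  rw [QuotientGroup.eq]
  refine Subgroup.le_topologicalClosure _ (Subgroup.subset_normalClosure ?_)
  refine ⟨⁅β⁻¹, α⁻¹⁆, Subgroup.le_topologicalClosure _
    (Subgroup.commutator_mem_commutator (Subgroup.mem_top _) (Subgroup.mem_top _)), ?_⟩
  rw [commutatorElement_def]
  simp only [map_mul, map_inv, inv_inv, mul_inv_rev, mul_assoc]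

/-- Points over two finite extensions of coprime degrees give a splitting of
`π₁(Spec B)^(ab) → G_k`, for a normal domain `B` over `k`. -/
theorem exists_section_projGalAb_of_coprime [IsAlgClosed Ω] {B : Type u} [CommRing B] [IsDomain B]
    [IsIntegrallyClosed B] [Algebra k B] (η : Spec (.of Ω) ⟶ Spec (.of B))
    (hη : η ≫ Spec.map (CommRingCat.ofHom (algebraMap k B)) = specAlg k Ω)
    {L₁ L₂ : Type u} [Field L₁] [Field L₂] [Algebra k L₁] [Algebra k L₂]
    [FiniteDimensional k L₁] [FiniteDimensional k L₂] (χ₁ : B →ₐ[k] L₁) (χ₂ : B →ₐ[k] L₂)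
    (hcop : (Module.finrank k L₁).Coprime (Module.finrank k L₂)) :
    ∃ s : Gal(algebraicClosure k Ω/k) →ₜ*
        Pi1GeomAb (Spec.map (CommRingCat.ofHom (algebraMap k B))) η hη,
      ∀ g, projGalAb (Spec.map (CommRingCat.ofHom (algebraMap k B))) η hη (s g) = g := by
  obtain ⟨H₁, ho₁, hi₁, s₁, hs₁, hq₁⟩ := exists_section_of_algHom η hη χ₁
  obtain ⟨H₂, ho₂, hi₂, s₂, hs₂, hq₂⟩ := exists_section_of_algHom η hη χ₂
  have : H₁.FiniteIndex := ⟨hi₁ ▸ Module.finrank_pos.ne'⟩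
  have : H₂.FiniteIndex := ⟨hi₂ ▸ Module.finrank_pos.ne'⟩
  exact exists_continuous_section_of_coprime_index
    (isMulCommutative_ker_projGalAb _ η hη (ker_projGal_le_range_geomToArith hη))
    H₁ H₂ ho₁ ho₂ (by rwa [hi₁, hi₂])
    ((QuotientGroup.mk' _).comp s₁) (continuous_quotient_mk'.comp hs₁) hq₁
    ((QuotientGroup.mk' _).comp s₂) (continuous_quotient_mk'.comp hs₂) hq₂

end GeomAb

end EtaleFG

open EtaleFG
theorem propositionC (p : ℕ) [Fact p.Prime] (k : Type u) [Field k] [CharZero k]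
    [Algebra ℚ_[p] k] [FiniteDimensional ℚ_[p] k] [Algebra ℤ_[p] k] [IsScalarTower ℤ_[p] ℚ_[p] k]
    (π : integralClosure ℤ_[p] k) (hπ : Irreducible π) (n : ℕ) (hn : 1 ≤ n)
    (Ω : Type u) [Field Ω] [IsAlgClosed Ω] [Algebra k Ω]
    (η : Spec (.of Ω) ⟶ openAnnulus (integralClosure ℤ_[p] k) k π n)
    (hη : η ≫ openAnnulus.toSpec (integralClosure ℤ_[p] k) k π n = specAlg k Ω) :
    ∃ s : Gal(algebraicClosure k Ω/k) →ₜ*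
        Pi1GeomAb (openAnnulus.toSpec (integralClosure ℤ_[p] k) k π n) η hη,
      ∀ g, projGalAb (openAnnulus.toSpec (integralClosure ℤ_[p] k) k π n) η hη (s g) = g := by
  have := isLocalRing_padicIntegers p k
  have := isDedekindDomain_padicIntegers p k
  have := isPrincipalIdealRing_padicIntegers p k
  have := isFractionRing_padicIntegers p k
  have := isAdicComplete_padicIntegers p k hπ.ne_zero hπ.not_isUnit
  have hmax : (Ideal.span {π}).IsMaximal := PrincipalIdealRing.isMaximal_of_irreducible hπ
  obtain ⟨_, _⟩ := annulusRing_normal (π := π) hπ.ne_zero hn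
  -- The ring of `C_n` is not zero, because it maps to `Ω`.
  have : Nontrivial (TensorProduct (integralClosure ℤ_[p] k) k
      (AnnulusRing (integralClosure ℤ_[p] k) π n)) :=
    (Spec.preimage (show Spec (.of Ω) ⟶ Spec (.of _) from η)).hom.domain_nontrivial
  obtain ⟨_, _⟩ := tensor_normal (O := integralClosure ℤ_[p] k)
    (AnnulusRing (integralClosure ℤ_[p] k) π n) k
  obtain ⟨L₁, _, _, _, h₁, ⟨χ₁⟩⟩ := exists_algHom_tensor_annulusRing hπ.prime k (n := n)
    (d := n + 1) (by omega)
  obtain ⟨L₂, _, _, _, h₂, ⟨χ₂⟩⟩ := exists_algHom_tensor_annulusRing hπ.prime k (n := n)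
    (d := n + 2) (by omega)
  exact exists_section_projGalAb_of_coprime η hη χ₁ χ₂
    (by
      rw [h₁, h₂, show n + 2 = n + 1 + 1 from rfl, Nat.coprime_self_add_right]
      exact Nat.coprime_one_right _)
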